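/- A quadriculated disk $\Delta$ is a closed topological disk formed by the juxtaposition along sides of finitely many squares (a square being a topological disk with four marked boundary points, its vertices), such that every vertex in the interior of $\Delta$ belongs to precisely four squares. The squares are colored black and white so that squares with a common side have opposite colors; label the black squares by $1,\dots,b$ and the white squares by $1,\dots,w$, in any order. The black-to-white matrix $B_\Delta$ is the $b\times w$ integer matrix whose $(i,j)$ entry is $1$ if the $i$-th black and the $j$-th white square share a side, and $0$ otherwise. Let $\Delta$ be a quadriculated disk with black-to-white matrix $B_\Delta$. Then: 1. for every $v\in\mathbb{Z}^b$, if the system $B_\Delta x=v$ has a solution $x\in\mathbb{Q}^w$, then it has a solution $x\in\mathbb{Z}^w$; 2. the cokernel $\mathbb{Z}^b/B_\Delta(\mathbb{Z}^w)$ of $B_\Delta:\mathbb{Z}^w\to\mathbb{Z}^b$ is a free abelian group; 3. for every prime $p$, the rank of $B_\Delta$ over $\mathbb{F}_p$ equals its rank over $\mathbb{Q}$. -/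

import Mathlib

open scoped unitInterval

/-- A point of the boundary of the model square `[0,1] × [0,1]`: side `i` is run through
counterclockwise, from vertex `i` to vertex `i + 1`, as `t` goes from `0` to `1`. The vertices
`0, 1, 2, 3` are `(0,0), (1,0), (1,1), (0,1)`. -/
def sidePoint (i : Fin 4) (t : I) : I × I :=
  ![(t, 0), (1, t), (σ t, 1), (0, σ t)] i

/-- Instructions for juxtaposing squares along sides. The squares are indexed by `F`, the sides of
the square `f` are the `(f, i)` with `i : Fin 4`. `mate s = some s'` says that the side `s` is glued
to the side `s'`, and `mate s = none` that `s` is glued to no other side. -/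
structure SquareGluing (F : Type*) where
  mate : F × Fin 4 → Option (F × Fin 4)
  mate_symm : ∀ s s', mate s = some s' → mate s' = some s
  mate_ne_self : ∀ s, mate s ≠ some s

namespace SquareGluing

variable {F : Type*} (G : SquareGluing F)

/-- The identifications of points in the disjoint union of the squares: glued sides are identified
with opposite directions. (All squares are parametrized compatibly with one orientation of the
resulting surface, so that the two squares at a common side run through it in opposite
directions.) -/
inductive PointRel : (Σ _ : F, I × I) → (Σ _ : F, I × I) → Prop
  | glue (f g : F) (i j : Fin 4) (h : G.mate (f, i) = some (g, j)) (t : I) :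
      PointRel ⟨f, sidePoint i t⟩ ⟨g, sidePoint j (σ t)⟩

/-- The topological space obtained by gluing: the disjoint union of the squares modulo the
equivalence relation generated by the identifications, with the quotient topology. -/
abbrev Space : Type _ := Quot G.PointRel

/-- The point of the glued space at parameter `t` of the side `s`. -/
def sideMap (s : F × Fin 4) (t : I) : G.Space :=
  Quot.mk _ ⟨s.1, sidePoint s.2 t⟩

/-- The point of the glued space at the corner `c = (f, i)`, i.e. at vertex `i` of the
square `f`. -/
def vertex (c : F × Fin 4) : G.Space := G.sideMap c 0

/-- The boundary of the glued surface: the union of the sides that are glued to no other side. -/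
def boundary : Set G.Space :=
  {x | ∃ s t, G.mate s = none ∧ G.sideMap s t = x}

/-- `G` describes a quadriculated disk: the glued space is a closed topological disk, and every
interior vertex belongs to precisely four squares (exactly four corners of squares are at it). -/
structure IsQuadriculatedDisk : Prop where
  disk : Nonempty (G.Space ≃ₜ Metric.closedBall (0 : EuclideanSpace ℝ (Fin 2)) 1)
  four : ∀ c : F × Fin 4, G.vertex c ∉ G.boundary →
    {c' : F × Fin 4 | G.vertex c' = G.vertex c}.ncard = 4

/-- Two squares share a side. -/
def ShareSide (f g : F) : Prop :=
  ∃ i j : Fin 4, G.mate (f, i) = some (g, j)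

/-- A bicoloring of the squares (`true` is black, `false` is white): squares with a common side have
opposite colors. -/
def IsBicoloring (color : F → Bool) : Prop :=
  ∀ f g, G.ShareSide f g → color f ≠ color g

open Classical in
/-- The `b × w` black-to-white matrix, for a labeling `black` of the black squares by `Fin b`
and a labeling `white` of the white squares by `Fin w`. -/
noncomputable def blackToWhite {color : F → Bool} {b w : ℕ}
    (black : Fin b ≃ {f : F // color f = true}) (white : Fin w ≃ {f : F // color f = false}) :
    Matrix (Fin b) (Fin w) ℤ :=
  Matrix.of fun i j => if G.ShareSide (black i) (white j) then 1 else 0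

end SquareGluing

/-! Everything reduces to saturation of the image of the matrix B: if B x = n v with n ≠ 0, then v
is in the image. The cokernel is then torsion-free, hence free, so B factors over ℤ as a split
injection after a split surjection and has the same rank over every field. Saturation follows from
lifting: a function on the white squares whose neighbor sums at black squares vanish mod n is
congruent mod n to one whose sums vanish (`exists_neighborSum_eq_zero`).

Lifting becomes a question about flows in a graph. As interior vertices have four squares, the disk
develops into the square grid (`exists_direction`, `exists_coordinate`), and signs alternating by
rows (`exists_sign`) turn the neighbor sum, up to sign, into y₀ - y₁ + y₂ - y₃, with yᵢ the signed
value across side i. It vanishes iff the jumps of y at opposite corners of the black square are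
opposite, i.e. the jumps are a flow along its two diagonals. The jumps around an interior vertex
cancel; letting boundary sides of white squares carry their value as flow gives conservation at
boundary vertices too. A flow conserved mod n lifts to a conserved integral flow
(`exists_flow_lift`), which is then integrated back to a function.

Besides connectedness (`induction_on_squares`), the topology used is simple connectivity, in the
form `exists_potential_of_corner`. It gives exactness of closed cochains, existence of the boundary
by a count, and connectedness of the boundary; the last fixes the additive constant so that the lift
vanishes at black boundary sides. -/

set_option linter.unnecessarySeqFocus false

namespace SquareGluing

variable {F : Type*} (G : SquareGluing F)

/-! ### Topology of the disk: lifting to the line, connectedness -/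

/-- The bilinear function on the unit square with value `v i` at vertex `i`. -/
def bilinear (v : Fin 4 → ℝ) (p : I × I) : ℝ :=
  (1 - p.1) * (1 - p.2) * v 0 + p.1 * (1 - p.2) * v 1 + p.1 * p.2 * v 2 + (1 - p.1) * p.2 * v 3

theorem continuous_bilinear (v : Fin 4 → ℝ) : Continuous (bilinear v) := by
  unfold bilinear
  fun_prop

theorem bilinear_sidePoint (v : Fin 4 → ℝ) (i : Fin 4) (t : I) :
    bilinear v (sidePoint i t) = (1 - t) * v i + t * v (i + 1) := by
  fin_cases i <;> simp [bilinear, sidePoint] <;> ring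

/-- A continuous map from the disk to the circle lifts to the line. -/
theorem IsQuadriculatedDisk.exists_lift {G : SquareGluing F} (hG : G.IsQuadriculatedDisk)
    (h : C(G.Space, AddCircle (1 : ℝ))) :
    ∃ H : C(G.Space, ℝ), ∀ x, ((H x : ℝ) : AddCircle (1 : ℝ)) = h x := by
  obtain ⟨e⟩ := hG.disk
  have hmem : ∀ (s : I) (y : Metric.closedBall (0 : EuclideanSpace ℝ (Fin 2)) 1),
      (s : ℝ) • (y : EuclideanSpace ℝ (Fin 2)) ∈ Metric.closedBall 0 1 := by
    intro s y
    have hy := y.2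
    rw [mem_closedBall_zero_iff] at hy ⊢
    rw [norm_smul, Real.norm_of_nonneg s.2.1]
    exact mul_le_one₀ s.2.2 (norm_nonneg _) hy
  -- The radial contraction of the disk deforms `h` at time 1 to a constant at time 0, and a
  -- constant lifts.
  let K : C(I × G.Space, AddCircle (1 : ℝ)) :=
    ⟨fun q => h (e.symm ⟨_, hmem q.1 (e q.2)⟩), by fun_prop⟩
  obtain ⟨r, hr⟩ := QuotientAddGroup.mk_surjective
    (h (e.symm ⟨0, Metric.mem_closedBall_self zero_le_one⟩))
  have hK : ∀ x, K (0, x) = ((ContinuousMap.const G.Space r x : ℝ) : AddCircle (1 : ℝ)) := by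
    intro x
    simp only [K, ContinuousMap.coe_mk, ContinuousMap.const_apply]
    refine Eq.trans ?_ hr.symm
    congr 3
    simp
  have cov := AddCircle.isCoveringMap_coe (1 : ℝ)
  refine ⟨(cov.liftHomotopy K _ hK).comp ⟨fun x => (1, x), by fun_prop⟩, fun x => ?_⟩
  have := congrFun (cov.liftHomotopy_lifts K _ hK) (1, x)
  refine Eq.trans this ?_
  simp [K]

/-- Local systems with integral monodromy on a quadriculated disk are trivial. -/
theorem IsQuadriculatedDisk.exists_potential_of_corner {G : SquareGluing F}
    (hG : G.IsQuadriculatedDisk) (a : F × Fin 4 → ℝ) (t : F × Fin 4 → ℤ)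
    (h0 : ∀ f i g j, G.mate (f, i) = some (g, j) → a (f, i) - a (g, j + 1) = t (f, i))
    (h1 : ∀ f i g j, G.mate (f, i) = some (g, j) → a (f, i + 1) - a (g, j) = t (f, i)) :
    ∃ τ : F → ℤ, ∀ f i g j, G.mate (f, i) = some (g, j) → τ f - τ g = t (f, i) := by
  -- Interpolated corner values differ across a glued side by the integer `t`, so they agree modulo
  -- 1 and define a map to the circle.
  let k : (Σ _ : F, I × I) → AddCircle (1 : ℝ) := fun q =>
    ((bilinear (fun i => a (q.1, i)) q.2 : ℝ) : AddCircle (1 : ℝ))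
  have hk : Continuous k := by
    refine continuous_sigma fun f => ?_
    exact (AddCircle.continuous_mk' 1).comp (continuous_bilinear fun i => a (f, i))
  have hrel : ∀ x y, G.PointRel x y → k x = k y := by
    rintro _ _ ⟨f, g, i, j, h, t'⟩
    simp only [k, bilinear_sidePoint]
    rw [← sub_eq_zero, ← AddCircle.coe_sub, AddCircle.coe_eq_zero_iff]
    refine ⟨t (f, i), ?_⟩
    have e0 := h0 f i g j h
    have e1 := h1 f i g j h
    simp only [unitInterval.coe_symm_eq, zsmul_eq_mul, mul_one]
    linear_combination (-1 + (t' : ℝ)) * e0 - (t' : ℝ) * e1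
  obtain ⟨H, hH⟩ := hG.exists_lift ⟨Quot.lift k hrel, continuous_quot_lift hrel hk⟩
  -- On one square, the interpolation minus the lift is continuous and integer-valued, hence
  -- constant; this constant is the potential.
  have key : ∀ f, ∃ n : ℤ, ∀ p : I × I,
      H (Quot.mk _ ⟨f, p⟩) = bilinear (fun i => a (f, i)) p - n := by
    intro f
    have hint : ∀ p : I × I, ∃ n : ℤ,
        bilinear (fun i => a (f, i)) p - H (Quot.mk _ ⟨f, p⟩) = n := by
      intro p
      have := hH (Quot.mk _ ⟨f, p⟩)
      have h2 : ((H (Quot.mk _ ⟨f, p⟩) : ℝ) : AddCircle (1 : ℝ)) =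
        ((bilinear (fun i => a (f, i)) p : ℝ) : AddCircle (1 : ℝ)) := this
      rw [eq_comm, ← sub_eq_zero, ← AddCircle.coe_sub, AddCircle.coe_eq_zero_iff] at h2
      obtain ⟨n, hn⟩ := h2
      exact ⟨n, by rw [← hn]; simp⟩
    choose n hn using hint
    have hc : Continuous n := by
      rw [Int.isClosedEmbedding_coe_real.isEmbedding.continuous_iff]
      have : ((↑) : ℤ → ℝ) ∘ n = fun p => bilinear (fun i => a (f, i)) p -
          H (Quot.mk _ ⟨f, p⟩) := funext fun p => (hn p).symm
      rw [this]
      refine (continuous_bilinear _).sub (H.continuous.comp ?_)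
      exact continuous_quot_mk.comp continuous_sigmaMk
    refine ⟨n (0, 0), fun p => ?_⟩
    have := PreconnectedSpace.constant inferInstance hc (x := p) (y := (0, 0))
    rw [← this, ← hn p]
    ring
  choose τ hτ using key
  refine ⟨τ, fun f i g j h => ?_⟩
  have hq : (Quot.mk G.PointRel ⟨f, sidePoint i 0⟩ : G.Space) =
      Quot.mk G.PointRel ⟨g, sidePoint j (σ 0)⟩ := Quot.sound (.glue f g i j h 0)
  have e1 := hτ f (sidePoint i 0)
  have e2 := hτ g (sidePoint j (σ 0))
  rw [bilinear_sidePoint] at e1 e2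
  rw [hq] at e1
  have e3 := h0 f i g j h
  simp at e1 e2
  have : ((τ f - τ g : ℤ) : ℝ) = (t (f, i) : ℤ) := by
    push_cast
    linarith
  exact_mod_cast this

/-- The squares of a quadriculated disk are connected through common sides. -/
theorem IsQuadriculatedDisk.induction_on_squares {G : SquareGluing F}
    (hG : G.IsQuadriculatedDisk) (P : F → Prop)
    (hP : ∀ f i g j, G.mate (f, i) = some (g, j) → P f → P g) (f g : F) (hf : P f) : P g := by
  obtain ⟨e⟩ := hG.disk
  have hconn : PreconnectedSpace G.Space := by
    have : PreconnectedSpace (Metric.closedBall (0 : EuclideanSpace ℝ (Fin 2)) 1) :=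
      Subtype.preconnectedSpace (convex_closedBall _ _).isPreconnected
    exact e.symm.surjective.denseRange.preconnectedSpace e.symm.continuous
  let _ : TopologicalSpace Prop := ⊥
  have : DiscreteTopology Prop := ⟨rfl⟩
  let k : (Σ _ : F, I × I) → Prop := fun q => P q.1
  have hk : Continuous k := continuous_sigma fun f => (continuous_const : Continuous fun _ => P f)
  have hrel : ∀ x y, G.PointRel x y → k x = k y := by
    rintro _ _ ⟨f, g, i, j, h, t⟩
    exact propext ⟨hP f i g j h, hP g j f i (G.mate_symm _ _ h)⟩
  have hl : Continuous (Quot.lift k hrel : G.Space → Prop) := continuous_quot_lift hrel hk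
  have := PreconnectedSpace.constant hconn hl (x := Quot.mk _ ⟨f, (0, 0)⟩)
    (y := Quot.mk _ ⟨g, (0, 0)⟩)
  exact cast this hf

theorem IsQuadriculatedDisk.nonempty {G : SquareGluing F} (hG : G.IsQuadriculatedDisk) :
    Nonempty F := by
  obtain ⟨e⟩ := hG.disk
  obtain ⟨q, -⟩ := Quot.exists_rep
    (e.symm ⟨0, Metric.mem_closedBall_self zero_le_one⟩)
  exact ⟨q.1⟩

/-! ### Combinatorial and topological vertices -/

/-- The corner reached from the corner `(f, i)` by crossing side `i`, i.e. by turning once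
around the vertex. -/
def nextCorner (c : F × Fin 4) : Option (F × Fin 4) :=
  (G.mate c).map fun s => (s.1, s.2 + 1)

theorem nextCorner_eq_some_iff {c c' : F × Fin 4} :
    G.nextCorner c = some c' ↔ G.mate c = some (c'.1, c'.2 - 1) := by
  constructor
  · intro h
    obtain ⟨s, hs, rfl⟩ := Option.map_eq_some_iff.1 h
    simp [hs]
  · intro h
    simp [nextCorner, h]

/-- The combinatorial vertices: corners up to turning. -/
def Vtx : Type _ := Quot fun c c' => G.nextCorner c = some c'

/-- The combinatorial vertex at a corner. -/
def vtx (c : F × Fin 4) : G.Vtx := Quot.mk _ c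

variable {G}

theorem vtx_of_mate {f g : F} {i j : Fin 4} (h : G.mate (f, i) = some (g, j)) :
    G.vtx (f, i) = G.vtx (g, j + 1) :=
  Quot.sound (by simp [nextCorner, h])

theorem vtx_succ_of_mate {f g : F} {i j : Fin 4} (h : G.mate (f, i) = some (g, j)) :
    G.vtx (f, i + 1) = G.vtx (g, j) :=
  (vtx_of_mate (G.mate_symm _ _ h)).symm

theorem nextCorner_injective {c c' d : F × Fin 4} (h : G.nextCorner c = some d)
    (h' : G.nextCorner c' = some d) : c = c' := by
  rw [nextCorner_eq_some_iff] at h h'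
  exact Option.some_injective _ ((G.mate_symm _ _ h).symm.trans (G.mate_symm _ _ h'))

theorem vtx_ind {P : F × Fin 4 → Prop}
    (hP : ∀ c c', G.nextCorner c = some c' → (P c ↔ P c')) {c c' : F × Fin 4}
    (h : G.vtx c = G.vtx c') : P c ↔ P c' := by
  have := congrArg (Quot.lift P fun a b hab => propext (hP a b hab)) h
  exact iff_of_eq this

theorem sidePoint_one (i : Fin 4) : sidePoint i 1 = sidePoint (i + 1) 0 := by
  fin_cases i <;> simp [sidePoint]

theorem sideMap_of_mate {f g : F} {i j : Fin 4} (h : G.mate (f, i) = some (g, j)) (t : I) :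
    G.sideMap (f, i) t = G.sideMap (g, j) (σ t) :=
  Quot.sound (.glue f g i j h t)

theorem vertex_eq_of_vtx_eq {c c' : F × Fin 4} (h : G.vtx c = G.vtx c') :
    G.vertex c = G.vertex c' := by
  have hrel : ∀ a b, G.nextCorner a = some b → G.vertex a = G.vertex b := by
    rintro ⟨f, i⟩ ⟨g, j⟩ hab
    rw [nextCorner_eq_some_iff] at hab
    have := sideMap_of_mate hab 0
    rw [vertex, this, vertex, sideMap, sideMap]
    simp [sidePoint_one]
  exact congrArg (Quot.lift G.vertex hrel) h

open Classical in
/-- The vertex at which a point of a square lies, if any. -/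
noncomputable def vtxAt (q : Σ _ : F, I × I) : Option G.Vtx :=
  if q.2 = (0, 0) then some (G.vtx (q.1, 0))
  else if q.2 = (1, 0) then some (G.vtx (q.1, 1))
  else if q.2 = (1, 1) then some (G.vtx (q.1, 2))
  else if q.2 = (0, 1) then some (G.vtx (q.1, 3)) else none

open Classical in
theorem vtxAt_sidePoint (f : F) (i : Fin 4) (t : I) :
    G.vtxAt ⟨f, sidePoint i t⟩ = if t = 0 then some (G.vtx (f, i))
      else if t = 1 then some (G.vtx (f, i + 1)) else none := by
  have h10 : (1 : I) ≠ 0 := one_ne_zero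
  by_cases h0 : t = 0
  · subst h0
    fin_cases i <;> simp [vtxAt, sidePoint]
  by_cases h1 : t = 1
  · subst h1
    fin_cases i <;> simp [vtxAt, sidePoint]
  fin_cases i <;> simp [vtxAt, sidePoint, h0, h1, unitInterval.symm_eq_zero, unitInterval.symm_eq_one]

theorem vtxAt_eq_of_pointRel {q q' : Σ _ : F, I × I} (h : G.PointRel q q') :
    G.vtxAt q = G.vtxAt q' := by
  obtain ⟨f, g, i, j, h, t⟩ := h
  classical
  simp only [vtxAt_sidePoint, unitInterval.symm_eq_zero, unitInterval.symm_eq_one]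
  by_cases h0 : t = 0
  · simp [h0, vtx_of_mate h]
  by_cases h1 : t = 1
  · simp [h1, vtx_succ_of_mate h]
  simp [h0, h1]

/-- The combinatorial vertex at a point of the glued space, if any. -/
noncomputable def spaceVtx : G.Space → Option G.Vtx :=
  Quot.lift G.vtxAt fun _ _ => vtxAt_eq_of_pointRel

theorem spaceVtx_vertex (c : F × Fin 4) : spaceVtx (G.vertex c) = some (G.vtx c) := by
  classical
  exact (vtxAt_sidePoint c.1 c.2 0).trans (by simp)

/-- The gluing respects `vtxAt`, so it descends to the space and recovers the combinatorial vertex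
from the point. This transfers the topological condition `four` to orbits of corners. -/
theorem vertex_eq_iff {c c' : F × Fin 4} : G.vertex c = G.vertex c' ↔ G.vtx c = G.vtx c' := by
  refine ⟨fun h => ?_, vertex_eq_of_vtx_eq⟩
  have := congrArg spaceVtx h
  rwa [spaceVtx_vertex, spaceVtx_vertex, Option.some_inj] at this

theorem exists_of_vertex_mem_boundary {c : F × Fin 4} (h : G.vertex c ∈ G.boundary) :
    ∃ s, G.mate s = none ∧ (G.vtx s = G.vtx c ∨ G.vtx (s.1, s.2 + 1) = G.vtx c) := by
  classical
  obtain ⟨s, t, hs, ht⟩ := h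
  refine ⟨s, hs, ?_⟩
  have := congrArg spaceVtx ht
  rw [spaceVtx_vertex] at this
  have h2 := (vtxAt_sidePoint (G := G) s.1 s.2 t).symm.trans this
  split_ifs at h2
  · exact .inl (Option.some_injective _ h2)
  · exact .inr (Option.some_injective _ h2)

/-! ### Turning around a vertex -/

variable (G) in
/-- Turning around a vertex, with `none` as the state outside of the disk. -/
def turn : Option (F × Fin 4) → Option (F × Fin 4) := fun o => o.bind G.nextCorner

@[simp] theorem turn_some (c : F × Fin 4) : G.turn (some c) = G.nextCorner c := rfl

@[simp] theorem turn_none : G.turn none = none := rfl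

theorem turn_injective {x y : Option (F × Fin 4)} {d : F × Fin 4} (hx : G.turn x = some d)
    (hy : G.turn y = some d) : x = y := by
  obtain ⟨a, rfl, ha⟩ := Option.bind_eq_some_iff.1 hx
  obtain ⟨b, rfl, hb⟩ := Option.bind_eq_some_iff.1 hy
  rw [nextCorner_injective ha hb]

theorem turn_iterate_none (k : ℕ) : G.turn^[k] none = none := by
  induction k with
  | zero => rfl
  | succ k ih => rw [Function.iterate_succ_apply, turn_none, ih]

theorem turn_iterate_injective (k : ℕ) {x y : Option (F × Fin 4)} {d : F × Fin 4}
    (hx : G.turn^[k] x = some d) (hy : G.turn^[k] y = some d) : x = y := by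
  induction k generalizing x y with
  | zero => exact hx.trans hy.symm
  | succ k ih =>
    rw [Function.iterate_succ_apply] at hx hy
    have h := ih hx hy
    cases hz : G.turn x with
    | none => rw [hz, turn_iterate_none] at hx; cases hx
    | some e => exact turn_injective hz (h ▸ hz)

variable (G) in
/-- Turning around the vertex of the corner `c` comes back to `c`. -/
def IsCyclic (c : F × Fin 4) : Prop := some c ∈ Function.periodicPts G.turn

theorem isCyclic_iff_of_nextCorner {c c' : F × Fin 4} (h : G.nextCorner c = some c') :
    G.IsCyclic c ↔ G.IsCyclic c' := by
  constructor
  · rintro ⟨n, hn, hp⟩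
    refine ⟨n, hn, ?_⟩
    rw [← h]
    exact hp.apply
  · rintro ⟨n, hn, hp⟩
    refine ⟨n, hn, ?_⟩
    have h1 : G.turn (G.turn^[n] (some c)) = some c' := by
      rw [← Function.iterate_succ_apply' G.turn, Function.iterate_succ_apply, turn_some, h]
      exact hp
    exact turn_injective h1 h

theorem isCyclic_iff_of_vtx_eq {c c' : F × Fin 4} (h : G.vtx c = G.vtx c') :
    G.IsCyclic c ↔ G.IsCyclic c' :=
  vtx_ind (fun _ _ => isCyclic_iff_of_nextCorner) h

theorem IsCyclic.mate_ne_none {c : F × Fin 4} (h : G.IsCyclic c) : G.mate c ≠ none := by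
  obtain ⟨n, hn, hp⟩ := h
  intro h0
  have h1 : G.turn (some c) = none := by simp [nextCorner, h0]
  obtain ⟨m, rfl⟩ := Nat.exists_eq_succ_of_ne_zero hn.ne'
  have h2 : G.turn^[m.succ] (some c) = some c := hp
  rw [Function.iterate_succ_apply, h1, turn_iterate_none] at h2
  cases h2

theorem IsCyclic.exists_prev {c : F × Fin 4} (h : G.IsCyclic c) :
    ∃ c', G.nextCorner c' = some c := by
  obtain ⟨n, hn, hp⟩ := h
  obtain ⟨m, rfl⟩ := Nat.exists_eq_succ_of_ne_zero hn.ne'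
  have h2 : G.turn^[m.succ] (some c) = some c := hp
  rw [Function.iterate_succ_apply'] at h2
  obtain ⟨b, -, hb⟩ := Option.bind_eq_some_iff.1 h2
  exact ⟨b, hb⟩

theorem IsCyclic.mate_pred_ne_none {c : F × Fin 4} (h : G.IsCyclic c) :
    G.mate (c.1, c.2 - 1) ≠ none := by
  obtain ⟨c', hc'⟩ := h.exists_prev
  rw [nextCorner_eq_some_iff] at hc'
  rw [G.mate_symm _ _ hc']
  simp

theorem IsCyclic.vertex_notMem_boundary {c : F × Fin 4} (h : G.IsCyclic c) :
    G.vertex c ∉ G.boundary := by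
  intro hb
  obtain ⟨s, hs, h1 | h1⟩ := exists_of_vertex_mem_boundary hb
  · exact ((isCyclic_iff_of_vtx_eq h1).2 h).mate_ne_none hs
  · have := ((isCyclic_iff_of_vtx_eq h1).2 h).mate_pred_ne_none
    simp [hs] at this

theorem IsCyclic.vtx_eq_iff {c : F × Fin 4} (h : G.IsCyclic c) (c' : F × Fin 4) :
    G.vtx c' = G.vtx c ↔ ∃ k, G.turn^[k] (some c) = some c' := by
  constructor
  · intro hv
    refine (vtx_ind (P := fun d => ∃ k, G.turn^[k] (some c) = some d) ?_ hv).2 ⟨0, rfl⟩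
    intro d d' hd
    constructor
    · rintro ⟨k, hk⟩
      exact ⟨k + 1, by rw [Function.iterate_succ_apply', hk]; exact hd⟩
    · rintro ⟨k, hk⟩
      obtain ⟨n, hn, hp⟩ := h
      have h2 : G.turn^[k + n] (some c) = some d' := by
        rw [Function.iterate_add_apply]
        exact (congrArg _ hp).trans hk
      obtain ⟨m, rfl⟩ := Nat.exists_eq_succ_of_ne_zero hn.ne'
      refine ⟨k + m, turn_injective (d := d') ?_ hd⟩
      rw [← Function.iterate_succ_apply' G.turn]
      exact h2
  · rintro ⟨k, hk⟩
    induction k generalizing c' with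
    | zero => exact congrArg _ (Option.some_injective _ hk).symm
    | succ k ih =>
      rw [Function.iterate_succ_apply'] at hk
      obtain ⟨b, hb, hb'⟩ := Option.bind_eq_some_iff.1 hk
      exact (Quot.sound hb' : G.vtx b = G.vtx c').symm.trans (ih b hb)

theorem IsCyclic.iterate_ne_none {c : F × Fin 4} (h : G.IsCyclic c) (k : ℕ) :
    G.turn^[k] (some c) ≠ none := by
  obtain ⟨n, hn, hp⟩ := h
  intro h0
  have h1 : G.turn^[n * k] (some c) = some c := (hp.mul_const k)
  obtain ⟨m, hm⟩ : ∃ m, n * k = m + k := ⟨n * k - k, by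
    have := Nat.le_mul_of_pos_left k hn
    omega⟩
  rw [hm, Function.iterate_add_apply, h0, turn_iterate_none] at h1
  cases h1

/-- Pigeonhole: an orbit that survives this many turns repeats a corner, and injectivity of turning
away from `none` cancels the initial segment. So at a non-cyclic corner turning runs out of the disk
within a uniform number of steps. -/
theorem isCyclic_of_iterate_ne_none [Finite F] {c : F × Fin 4}
    (h : G.turn^[Nat.card (F × Fin 4)] (some c) ≠ none) : G.IsCyclic c := by
  set N := Nat.card (F × Fin 4)
  have hne : ∀ k ≤ N, ∃ d, G.turn^[k] (some c) = some d := by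
    intro k hk
    refine Option.ne_none_iff_exists'.1 fun h0 => h ?_
    obtain ⟨m, hm⟩ := Nat.exists_eq_add_of_le' hk
    rw [hm, Function.iterate_add_apply, h0, turn_iterate_none]
  have : Nonempty (F × Fin 4) := ⟨c⟩
  choose! d hd using hne
  have : ∃ k l : Fin (N + 1), k ≠ l ∧ d k = d l := by
    by_contra! hinj
    have hinj' : Function.Injective fun k : Fin (N + 1) => d k := fun k l hkl => by
      by_contra hne
      exact hinj k l hne hkl
    have := Nat.card_le_card_of_injective _ hinj'
    simp only [Nat.card_fin] at this
    omega
  obtain ⟨k, l, hkl, hd'⟩ := this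
  wlog hlt : k < l generalizing k l
  · exact this l k hkl.symm hd'.symm (lt_of_le_of_ne (not_lt.1 hlt) hkl.symm)
  have hlt' : (k : ℕ) < l := hlt
  refine ⟨l - k, by omega, ?_⟩
  refine turn_iterate_injective (k : ℕ) (d := d k) ?_ (hd k (by omega))
  rw [← Function.iterate_add_apply, show (k : ℕ) + (l - k) = l by omega, hd', hd l (by omega)]

theorem IsQuadriculatedDisk.card_class (hG : G.IsQuadriculatedDisk) {c : F × Fin 4}
    (h : G.IsCyclic c) : {c' | G.vtx c' = G.vtx c}.ncard = 4 := by
  simpa only [vertex_eq_iff] using hG.four c h.vertex_notMem_boundary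

/-- The orbit of a cyclic corner is its whole vertex class, which has four elements because a cyclic
corner lies off the boundary. -/
theorem IsQuadriculatedDisk.minimalPeriod (hG : G.IsQuadriculatedDisk) {c : F × Fin 4}
    (h : G.IsCyclic c) : Function.minimalPeriod G.turn (some c) = 4 := by
  have hset : some '' {c' | G.vtx c' = G.vtx c} =
      (fun k => G.turn^[k] (some c)) '' Set.Iio (Function.minimalPeriod G.turn (some c)) := by
    ext o
    simp only [Set.mem_image, Set.mem_ofPred_eq, h.vtx_eq_iff, Set.mem_Iio]
    constructor
    · rintro ⟨c', ⟨k, hk⟩, rfl⟩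
      exact ⟨k % _, Nat.mod_lt _ (Function.minimalPeriod_pos_of_mem_periodicPts h),
        by rw [Function.iterate_mod_minimalPeriod_eq, hk]⟩
    · rintro ⟨k, -, rfl⟩
      obtain ⟨c', hc'⟩ := Option.ne_none_iff_exists'.1 (h.iterate_ne_none k)
      exact ⟨c', ⟨k, hc'⟩, hc'.symm⟩
  have hcard := congrArg Set.ncard hset
  rw [Set.ncard_image_of_injective _ (Option.some_injective _), hG.card_class h,
    Function.iterate_injOn_Iio_minimalPeriod.ncard_image] at hcard
  rw [← Finset.coe_range, Set.ncard_coe_finset, Finset.card_range] at hcard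
  exact hcard.symm

theorem IsQuadriculatedDisk.exists_four (hG : G.IsQuadriculatedDisk) {c : F × Fin 4}
    (h : G.IsCyclic c) : ∃ c₁ c₂ c₃, G.nextCorner c = some c₁ ∧ G.nextCorner c₁ = some c₂ ∧
      G.nextCorner c₂ = some c₃ ∧ G.nextCorner c₃ = some c ∧
      (c ≠ c₁ ∧ c ≠ c₂ ∧ c ≠ c₃ ∧ c₁ ≠ c₂ ∧ c₁ ≠ c₃ ∧ c₂ ≠ c₃) ∧
      ∀ c', G.vtx c' = G.vtx c ↔ c' = c ∨ c' = c₁ ∨ c' = c₂ ∨ c' = c₃ := by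
  have hm := hG.minimalPeriod h
  obtain ⟨c₁, h₁⟩ := Option.ne_none_iff_exists'.1 (h.iterate_ne_none 1)
  obtain ⟨c₂, h₂⟩ := Option.ne_none_iff_exists'.1 (h.iterate_ne_none 2)
  obtain ⟨c₃, h₃⟩ := Option.ne_none_iff_exists'.1 (h.iterate_ne_none 3)
  have h₄ : G.turn^[4] (some c) = some c := by
    have := Function.iterate_minimalPeriod (f := G.turn) (x := some c)
    rwa [hm] at this
  have hinj := Function.iterate_injOn_Iio_minimalPeriod (f := G.turn) (x := some c)
  rw [hm] at hinj
  have key : ∀ {k l : ℕ} {d e : F × Fin 4}, k < 4 → l < 4 → k ≠ l →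
      G.turn^[k] (some c) = some d → G.turn^[l] (some c) = some e → d ≠ e := by
    rintro k l d e hk hl hkl hd he rfl
    exact hkl (hinj (Set.mem_Iio.2 hk) (Set.mem_Iio.2 hl) (hd.trans he.symm))
  have h₀ : G.turn^[0] (some c) = some c := rfl
  refine ⟨c₁, c₂, c₃, h₁, ?_, ?_, ?_, ⟨?_, ?_, ?_, ?_, ?_, ?_⟩, fun c' => ?_⟩
  · rwa [Function.iterate_succ_apply', h₁] at h₂
  · rwa [Function.iterate_succ_apply', h₂] at h₃
  · rwa [Function.iterate_succ_apply', h₃] at h₄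
  · exact key (by norm_num) (by norm_num) (by norm_num) h₀ h₁
  · exact key (by norm_num) (by norm_num) (by norm_num) h₀ h₂
  · exact key (by norm_num) (by norm_num) (by norm_num) h₀ h₃
  · exact key (by norm_num) (by norm_num) (by norm_num) h₁ h₂
  · exact key (by norm_num) (by norm_num) (by norm_num) h₁ h₃
  · exact key (by norm_num) (by norm_num) (by norm_num) h₂ h₃
  · rw [h.vtx_eq_iff]
    constructor
    · rintro ⟨k, hk⟩
      rw [← Function.iterate_mod_minimalPeriod_eq, hm] at hk
      have : k % 4 < 4 := Nat.mod_lt _ (by norm_num)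
      generalize k % 4 = r at hk this
      interval_cases r
      · exact .inl (Option.some_injective _ (h₀.symm.trans hk)).symm
      · exact .inr (.inl (Option.some_injective _ (h₁.symm.trans hk)).symm)
      · exact .inr (.inr (.inl (Option.some_injective _ (h₂.symm.trans hk)).symm))
      · exact .inr (.inr (.inr (Option.some_injective _ (h₃.symm.trans hk)).symm))
    · rintro (rfl | rfl | rfl | rfl)
      exacts [⟨0, h₀⟩, ⟨1, h₁⟩, ⟨2, h₂⟩, ⟨3, h₃⟩]

open Classical in
theorem IsQuadriculatedDisk.exists_four_sum [Fintype F] (hG : G.IsQuadriculatedDisk)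
    {c : F × Fin 4} (h : G.IsCyclic c) : ∃ c₁ c₂ c₃, G.nextCorner c = some c₁ ∧
      G.nextCorner c₁ = some c₂ ∧ G.nextCorner c₂ = some c₃ ∧ G.nextCorner c₃ = some c ∧
      ∀ φ : F × Fin 4 → ℤ, (∑ c', if G.vtx c' = G.vtx c then φ c' else 0) =
        φ c + φ c₁ + φ c₂ + φ c₃ := by
  obtain ⟨c₁, c₂, c₃, h₁, h₂, h₃, h₄, ⟨n1, n2, n3, n4, n5, n6⟩, hv⟩ := hG.exists_four h
  refine ⟨c₁, c₂, c₃, h₁, h₂, h₃, h₄, fun φ => ?_⟩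
  have : Finset.univ.filter (fun c' => G.vtx c' = G.vtx c) = {c, c₁, c₂, c₃} := by
    ext c'
    simp [hv]
  rw [← Finset.sum_filter, this, Finset.sum_insert (by simp [*]), Finset.sum_insert (by simp [*]),
    Finset.sum_insert (by simp [*]), Finset.sum_singleton]
  ring

/-! ### Integral potentials and exactness of closed cochains -/

/-- Local systems with integral monodromy, given by their transition functions across the sides,
are trivial on a quadriculated disk if the monodromy around every interior vertex is trivial. -/
theorem IsQuadriculatedDisk.exists_potential [Finite F] (hG : G.IsQuadriculatedDisk)
    (t : F × Fin 4 → ℤ) (ht : ∀ s s', G.mate s = some s' → t s' = -t s)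
    (hc : ∀ c c₁ c₂ c₃, G.IsCyclic c → G.nextCorner c = some c₁ → G.nextCorner c₁ = some c₂ →
      G.nextCorner c₂ = some c₃ → G.nextCorner c₃ = some c → t c + t c₁ + t c₂ + t c₃ = 0) :
    ∃ τ : F → ℤ, ∀ f i g j, G.mate (f, i) = some (g, j) → τ f - τ g = t (f, i) := by
  classical
  let T : Option (F × Fin 4) → ℝ := fun o => o.elim 0 fun c => (t c : ℝ)
  -- A solution of `a c - a c' = t c` along turning. On a 4-cycle with total zero, the weights 3/4,
  -- 1/2, 1/4 solve it; otherwise add up `t` until turning leaves the disk, where `T none = 0`.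
  let a : F × Fin 4 → ℝ := fun c =>
    if G.IsCyclic c then
      (3 * T (some c) + 2 * T (G.turn (some c)) + T (G.turn (G.turn (some c)))) / 4
    else ∑ k ∈ Finset.range (Nat.card (F × Fin 4)), T (G.turn^[k] (some c))
  have ha : ∀ c c', G.nextCorner c = some c' → a c - a c' = t c := by
    intro c c' h
    by_cases hcyc : G.IsCyclic c
    · have hcyc' := (isCyclic_iff_of_nextCorner h).1 hcyc
      obtain ⟨c₁, c₂, c₃, h₁, h₂, h₃, h₄, -⟩ := hG.exists_four hcyc
      have hsum := hc c c₁ c₂ c₃ hcyc h₁ h₂ h₃ h₄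
      obtain rfl : c₁ = c' := Option.some_injective _ (h₁.symm.trans h)
      simp only [a, if_pos hcyc, if_pos hcyc', turn_some, h₁, h₂, h₃, T, Option.elim]
      have : ((t c + t c₁ + t c₂ + t c₃ : ℤ) : ℝ) = 0 := by rw [hsum]; simp
      push_cast at this
      linarith
    · have hcyc' := fun h' => hcyc ((isCyclic_iff_of_nextCorner h).2 h')
      simp only [a, if_neg hcyc, if_neg hcyc', ← Finset.sum_sub_distrib]
      have e : ∀ k, G.turn^[k] (some c') = G.turn^[k + 1] (some c) := fun k => by
        rw [Function.iterate_succ_apply, turn_some, h]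
      simp only [e]
      rw [Finset.sum_range_sub', not_not.1 (mt isCyclic_of_iterate_ne_none hcyc)]
      simp [T]
  refine hG.exists_potential_of_corner a t (fun f i g j h => ha _ _ (by simp [nextCorner, h]))
    fun f i g j h => ?_
  have h' := G.mate_symm _ _ h
  have := ha (g, j) (f, i + 1) (by simp [nextCorner, h'])
  rw [ht _ _ h] at this
  push_cast at this
  linarith

/-- A closed integral cochain on the sides of a quadriculated disk is a coboundary. -/
theorem IsQuadriculatedDisk.exists_vtx_potential (hG : G.IsQuadriculatedDisk)
    (z : F × Fin 4 → ℤ) (hz : ∀ s s', G.mate s = some s' → z s' = -z s)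
    (hsum : ∀ f, ∑ i, z (f, i) = 0) :
    ∃ u : G.Vtx → ℤ, ∀ f i, u (G.vtx (f, i + 1)) - u (G.vtx (f, i)) = z (f, i) := by
  -- A primitive of `z` on each square separately. Its jump is the same at both ends of a glued
  -- side, so a potential on the squares removes the jumps.
  let a : F × Fin 4 → ℤ := fun c =>
    ![0, z (c.1, 0), z (c.1, 0) + z (c.1, 1), z (c.1, 0) + z (c.1, 1) + z (c.1, 2)] c.2
  have ha : ∀ f i, a (f, i + 1) - a (f, i) = z (f, i) := by
    intro f i
    have := hsum f
    rw [Fin.sum_univ_four] at this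
    fin_cases i <;> simp [a] <;> linarith
  have hmate : ∀ f i g j, G.mate (f, i) = some (g, j) →
      a (f, i + 1) - a (g, j) = a (f, i) - a (g, j + 1) := by
    intro f i g j h
    have h1 := ha f i
    have h2 := ha g j
    have h3 := hz _ _ h
    linarith
  obtain ⟨τ, hτ⟩ := hG.exists_potential_of_corner (fun c => (a c : ℝ))
    (fun c => ((G.mate c).elim 0 fun s => a c - a (s.1, s.2 + 1)))
    (fun f i g j h => by simp [h])
    (fun f i g j h => by
      have := hmate f i g j h
      simp only [h, Option.elim]
      exact_mod_cast this)
  have hu : ∀ c c', G.nextCorner c = some c' → a c - τ c.1 = a c' - τ c'.1 := by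
    rintro ⟨f, i⟩ c' h
    obtain ⟨⟨g, j⟩, hs, rfl⟩ := Option.map_eq_some_iff.1 h
    have := hτ f i g j hs
    simp only [hs, Option.elim] at this ⊢
    linarith
  refine ⟨Quot.lift (fun c => a c - τ c.1) hu, fun f i => ?_⟩
  have := ha f i
  change (a (f, i + 1) - τ f) - (a (f, i) - τ f) = _
  linarith

instance [Finite F] : Finite G.Vtx := inferInstanceAs (Finite (Quot _))

/-! ### Existence of the boundary -/

/-- Evaluation at a side of a function on the sides of black squares, extended by zero. -/
def evalBlack (color : F → Bool) (s : F × Fin 4) :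
    ({f // color f = true} × Fin 4 → ℤ) →ₗ[ℤ] ℤ :=
  if h : color s.1 = true then LinearMap.proj (⟨s.1, h⟩, s.2) else 0

variable (G) in
/-- Extension of a function on the sides of black squares to an antisymmetric function on all
sides. -/
def extendAntisymm (color : F → Bool) :
    ({f // color f = true} × Fin 4 → ℤ) →ₗ[ℤ] (F × Fin 4 → ℤ) :=
  LinearMap.pi fun s => evalBlack color s - (G.mate s).elim 0 (evalBlack color)

theorem extendAntisymm_mate (color : F → Bool) (w : {f // color f = true} × Fin 4 → ℤ)
    (s s' : F × Fin 4) (h : G.mate s = some s') :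
    G.extendAntisymm color w s' = - G.extendAntisymm color w s := by
  simp [extendAntisymm, h, G.mate_symm _ _ h]

theorem extendAntisymm_black {color : F → Bool} (hcolor : G.IsBicoloring color)
    (w : {f // color f = true} × Fin 4 → ℤ) (f : {f // color f = true}) (i : Fin 4) :
    G.extendAntisymm color w (f, i) = w (f, i) := by
  obtain ⟨f, hf⟩ := f
  rcases h : G.mate (f, i) with _ | s'
  · simp [extendAntisymm, h, evalBlack, hf]
  · have hc := hcolor f s'.1 ⟨i, s'.2, h⟩
    rw [hf, ne_comm, ne_eq, Bool.not_eq_true] at hc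
    simp [extendAntisymm, h, evalBlack, hf, hc]

/-- A rank count. Cochains on black sides have rank 4b; closedness imposes at most |F| conditions,
and closed ones are coboundaries, of rank at most |V| - 1 since constants have zero coboundary.
Hence 4b - |F| ≤ |F| - 1. -/
theorem IsQuadriculatedDisk.four_mul_card_black_lt [Fintype F] (hG : G.IsQuadriculatedDisk)
    {color : F → Bool} (hcolor : G.IsBicoloring color)
    (hcard : Nat.card G.Vtx = Fintype.card F) :
    4 * Fintype.card {f // color f = true} < 2 * Fintype.card F := by
  classical
  have := Fintype.ofFinite G.Vtx
  rw [Nat.card_eq_fintype_card] at hcard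
  let Ψ : ({f // color f = true} × Fin 4 → ℤ) →ₗ[ℤ] (F → ℤ) :=
    (LinearMap.pi fun f => ∑ i : Fin 4, LinearMap.proj (f, i)).comp
      (G.extendAntisymm color)
  let δ : (G.Vtx → ℤ) →ₗ[ℤ] ({f // color f = true} × Fin 4 → ℤ) :=
    LinearMap.pi fun s : {f // color f = true} × Fin 4 =>
      (LinearMap.proj (G.vtx (s.1, s.2 + 1)) : (G.Vtx → ℤ) →ₗ[ℤ] ℤ) -
        LinearMap.proj (G.vtx (s.1, s.2))
  have hle : LinearMap.ker Ψ ≤ LinearMap.range δ := by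
    intro w hw
    obtain ⟨u, hu⟩ := hG.exists_vtx_potential _ (extendAntisymm_mate color w) (fun f => by
      have := congrFun (LinearMap.mem_ker.1 hw) f
      simpa [Ψ] using this)
    refine ⟨u, funext fun s => ?_⟩
    have := hu s.1 s.2
    simpa [δ, extendAntisymm_black hcolor] using this
  have h1 := Submodule.finrank_quotient_add_finrank (LinearMap.ker Ψ)
  rw [Ψ.quotKerEquivRange.finrank_eq] at h1
  have h2 := Submodule.finrank_quotient_add_finrank (LinearMap.ker δ)
  rw [δ.quotKerEquivRange.finrank_eq] at h2
  have h3 := Submodule.finrank_mono hle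
  have h4 := Submodule.finrank_le (LinearMap.range Ψ)
  have h5 : 0 < Module.finrank ℤ (LinearMap.ker δ) := by
    obtain ⟨f⟩ := hG.nonempty
    have h1 : (fun _ => 1 : G.Vtx → ℤ) ∈ LinearMap.ker δ := by
      rw [LinearMap.mem_ker]
      ext s
      simp [δ]
    have : Nontrivial (LinearMap.ker δ) := by
      refine ⟨⟨_, h1⟩, 0, fun h => ?_⟩
      have := congrFun (congrArg Subtype.val h) (G.vtx (f, 0))
      simp at this
    exact Module.finrank_pos
  simp only [Module.finrank_fintype_fun_eq_card, Fintype.card_prod, Fintype.card_fin] at h1 h2 h4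
  omega

/-- A quadriculated disk has a boundary. -/
theorem IsQuadriculatedDisk.exists_mate_eq_none [Finite F] (hG : G.IsQuadriculatedDisk)
    {color : F → Bool} (hcolor : G.IsBicoloring color) : ∃ s, G.mate s = none := by
  classical
  by_contra! hne
  have := Fintype.ofFinite F
  have := Fintype.ofFinite G.Vtx
  have hcyc : ∀ c, G.IsCyclic c := by
    intro c
    apply isCyclic_of_iterate_ne_none
    generalize Nat.card (F × Fin 4) = k
    induction k generalizing c with
    | zero => simp
    | succ k ih =>
      obtain ⟨d, hd⟩ := Option.ne_none_iff_exists'.1 (hne c)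
      rw [Function.iterate_succ_apply, turn_some, nextCorner, hd]
      exact ih _
  -- Without boundary every vertex has four corners, as every square does. The strict bound then
  -- holds for both colors, and adding the two gives 4|F| < 4|F|.
  have hcard : Nat.card G.Vtx = Fintype.card F := by
    have h1 := Finset.card_eq_sum_card_fiberwise (s := (Finset.univ : Finset (F × Fin 4)))
      (t := (Finset.univ : Finset G.Vtx)) (f := G.vtx) (by intro; simp)
    have h2 : ∀ v : G.Vtx, (Finset.univ.filter fun c => G.vtx c = v).card = 4 := by
      intro v
      obtain ⟨c, rfl⟩ := Quot.exists_rep v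
      have := hG.card_class (hcyc c)
      rw [← Set.ncard_coe_finset, Finset.coe_filter_univ]
      exact this
    rw [Finset.sum_congr rfl fun v _ => h2 v] at h1
    simp at h1
    rw [Nat.card_eq_fintype_card]
    omega
  have h1 := hG.four_mul_card_black_lt hcolor hcard
  have h2 := hG.four_mul_card_black_lt (color := fun f => !color f)
    (fun f g h h' => hcolor f g h (by simpa using h')) hcard
  have h3 := Fintype.card_subtype_compl fun f => color f = true
  have h4 := Fintype.card_subtype_le fun f => color f = true
  simp only [Bool.not_eq_true] at h3
  simp only [Bool.not_eq_true'] at h2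
  omega

theorem not_isCyclic_of_mate_eq_none {s : F × Fin 4} (h : G.mate s = none) :
    ¬ G.IsCyclic s ∧ ¬ G.IsCyclic (s.1, s.2 + 1) :=
  ⟨fun hc => hc.mate_ne_none h, fun hc => hc.mate_pred_ne_none (by simpa using h)⟩

/-! ### Developing the disk into the square grid -/

open Classical in
/-- Every integral function on the interior vertices of a quadriculated disk is the divergence of
an antisymmetric function on the sides. -/
theorem IsQuadriculatedDisk.exists_antisymm_sum_eq [Fintype F] (hG : G.IsQuadriculatedDisk)
    {color : F → Bool} (hcolor : G.IsBicoloring color) (m : G.Vtx → ℤ) :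
    ∃ n : F × Fin 4 → ℤ, (∀ s s', G.mate s = some s' → n s' = -n s) ∧
      ∀ c, G.IsCyclic c → (∑ c', if G.vtx c' = G.vtx c then n c' else 0) = m (G.vtx c) := by
  have := Fintype.ofFinite G.Vtx
  let S : AddSubgroup (G.Vtx → ℤ) :=
    { carrier := {m | ∃ n : F × Fin 4 → ℤ, (∀ s s', G.mate s = some s' → n s' = -n s) ∧
        ∀ c, G.IsCyclic c → (∑ c', if G.vtx c' = G.vtx c then n c' else 0) = m (G.vtx c)}
      zero_mem' := ⟨0, by simp, by simp⟩
      add_mem' := by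
        rintro m m' ⟨n, h1, h2⟩ ⟨n', h1', h2'⟩
        refine ⟨n + n', fun s s' h => ?_, fun c hc => ?_⟩
        · simp [h1 s s' h, h1' s s' h, add_comm]
        · rw [Pi.add_apply, ← h2 c hc, ← h2' c hc, ← Finset.sum_add_distrib]
          refine Finset.sum_congr rfl fun c' _ => ?_
          split_ifs <;> simp
      neg_mem' := by
        rintro m ⟨n, h1, h2⟩
        refine ⟨-n, fun s s' h => ?_, fun c hc => ?_⟩
        · simp [h1 s s' h]
        · rw [Pi.neg_apply, ← h2 c hc, ← Finset.sum_neg_distrib]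
          refine Finset.sum_congr rfl fun c' _ => ?_
          split_ifs <;> simp }
  -- A unit mass at a boundary vertex is free, as no condition is imposed there, and a mass moves
  -- along any interior side. So every mass can be carried to the boundary.
  let Q : F × Fin 4 → Prop := fun c => Pi.single (G.vtx c) 1 ∈ S
  have hnot : ∀ c, ¬ G.IsCyclic c → Q c := by
    intro c hc
    refine ⟨0, by simp, fun c' hc' => ?_⟩
    have : G.vtx c' ≠ G.vtx c := fun h => hc ((isCyclic_iff_of_vtx_eq h).1 hc')
    simp [this]
  have hstep : ∀ f i, Q (f, i) ↔ Q (f, i + 1) := by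
    intro f i
    cases hm : G.mate (f, i) with
    | none =>
      have := not_isCyclic_of_mate_eq_none hm
      exact iff_of_true (hnot _ this.1) (hnot _ this.2)
    | some s =>
      obtain ⟨g, j⟩ := s
      have hsub : (Pi.single (G.vtx (f, i)) 1 - Pi.single (G.vtx (f, i + 1)) 1 : G.Vtx → ℤ) ∈ S := by
        have hne : (f, i) ≠ (g, j) := fun h => G.mate_ne_self (f, i) (by rw [hm, h])
        have hiff : ∀ s s', G.mate s = some s' →
            ((s = (f, i) ↔ s' = (g, j)) ∧ (s = (g, j) ↔ s' = (f, i))) := by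
          intro s s' h
          have hm' := G.mate_symm _ _ hm
          have h' := G.mate_symm _ _ h
          constructor <;> constructor <;> rintro rfl <;> simp_all
        refine ⟨Pi.single (f, i) 1 - Pi.single (g, j) 1, fun s s' h => ?_, fun c hc => ?_⟩
        · obtain ⟨h1, h2⟩ := hiff s s' h
          simp only [Pi.sub_apply, Pi.single_apply, h1, h2]
          ring
        · rw [vtx_succ_of_mate hm, ← Finset.sum_filter]
          simp [Pi.single_apply, eq_comm]
      refine ⟨fun h => ?_, fun h => ?_⟩
      · have := S.sub_mem h hsub
        simpa using this
      · have := S.add_mem hsub h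
        simpa using this
  have hQ : ∀ f i, Q (f, i) ↔ Q (f, 0) := by
    intro f i
    have h0 := hstep f 0
    have h1 := hstep f 1
    have h2 := hstep f 2
    simp only [Fin.isValue, zero_add, Fin.reduceAdd] at h0 h1 h2
    fin_cases i
    · exact Iff.rfl
    · exact h0.symm
    · exact (h0.trans h1).symm
    · exact ((h0.trans h1).trans h2).symm
  obtain ⟨s, hs⟩ := hG.exists_mate_eq_none hcolor
  have hall : ∀ f, Q (f, 0) := fun f => by
    refine hG.induction_on_squares (fun f => Q (f, 0)) ?_ s.1 f
      ((hQ s.1 s.2).1 (hnot _ (not_isCyclic_of_mate_eq_none hs).1))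
    intro f i g j h hf
    rw [← hQ f i] at hf
    rw [← hQ g (j + 1)]
    change Pi.single (G.vtx (g, j + 1)) 1 ∈ S
    rw [← vtx_of_mate h]
    exact hf
  have hmem : m ∈ S := by
    have : m = ∑ v, m v • (Pi.single v 1 : G.Vtx → ℤ) := by
      ext v
      simp [Finset.sum_apply, Pi.single_apply]
    rw [this]
    refine S.sum_mem fun v _ => S.zsmul_mem ?_ _
    obtain ⟨c, rfl⟩ := Quot.exists_rep v
    exact (hQ c.1 c.2).2 (hall c.1)
  exact hmem

/-- The sides of the squares of a quadriculated disk have consistent directions. -/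
theorem IsQuadriculatedDisk.exists_direction [Finite F] (hG : G.IsQuadriculatedDisk)
    {color : F → Bool} (hcolor : G.IsBicoloring color) :
    ∃ r : F → ZMod 4, ∀ f i g j, G.mate (f, i) = some (g, j) →
      r g + ((j : ℕ) : ZMod 4) = r f + ((i : ℕ) : ZMod 4) + 2 := by
  classical
  have := Fintype.ofFinite F
  -- An integral lift of the rotation between neighboring squares. The half turn is 2 or -2
  -- according to color, to make `t₀` antisymmetric and to cancel around a vertex.
  let t₀ : F × Fin 4 → ℤ := fun s =>
    (G.mate s).elim 0 fun s' => s.2.val - s'.2.val + if color s.1 then 2 else -2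
  have ht₀ : ∀ s s', G.mate s = some s' →
      t₀ s = s.2.val - s'.2.val + if color s.1 then 2 else -2 := fun s s' h => by
    simp [t₀, h]
  have hne : ∀ s s', G.mate s = some s' → color s'.1 = !color s.1 := fun s s' h => by
    have := hcolor s.1 s'.1 ⟨s.2, s'.2, h⟩
    revert this
    cases color s.1 <;> cases color s'.1 <;> simp
  obtain ⟨n, hn, hsum⟩ := hG.exists_antisymm_sum_eq hcolor
    -- At an interior vertex the division is exact: the four corners contribute a multiple of 4.
    -- Subtracting `4 * n` kills the integral monodromy without changing `t₀` mod 4.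
    (fun v => (∑ c', if G.vtx c' = v then t₀ c' else 0) / 4)
  obtain ⟨τ, hτ⟩ := hG.exists_potential (fun s => t₀ s - 4 * n s)
    (fun s s' h => by
      have h' := G.mate_symm _ _ h
      simp only [ht₀ _ _ h, ht₀ _ _ h', hn _ _ h, hne _ _ h]
      cases color s.1 <;> simp <;> ring)
    (fun c c₁ c₂ c₃ hc h₁ h₂ h₃ h₄ => by
      obtain ⟨d₁, d₂, d₃, k₁, k₂, k₃, k₄, hd⟩ := hG.exists_four_sum hc
      obtain rfl : c₁ = d₁ := Option.some_injective _ (h₁.symm.trans k₁)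
      obtain rfl : c₂ = d₂ := Option.some_injective _ (h₂.symm.trans k₂)
      obtain rfl : c₃ = d₃ := Option.some_injective _ (h₃.symm.trans k₃)
      have e := hsum c hc
      rw [hd, hd] at e
      rw [nextCorner_eq_some_iff] at h₁ h₂ h₃ h₄
      have a₁ := ht₀ _ _ h₁
      have a₂ := ht₀ _ _ h₂
      have a₃ := ht₀ _ _ h₃
      have a₄ := ht₀ _ _ h₄
      have b₁ := hne _ _ h₁
      have b₂ := hne _ _ h₂
      have b₃ := hne _ _ h₃
      have hq : ∀ j : Fin 4, ∃ q : ℤ, ((j - 1 : Fin 4).val : ℤ) = j.val - 1 + 4 * q := by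
        intro j
        fin_cases j
        exacts [⟨1, rfl⟩, ⟨0, rfl⟩, ⟨0, rfl⟩, ⟨0, rfl⟩]
      obtain ⟨q₁, e₁⟩ := hq c₁.2
      obtain ⟨q₂, e₂⟩ := hq c₂.2
      obtain ⟨q₃, e₃⟩ := hq c₃.2
      obtain ⟨q₄, e₄⟩ := hq c.2
      simp only at b₁ b₂ b₃
      rw [b₃, b₂, b₁] at a₄
      rw [b₂, b₁] at a₃
      rw [b₁] at a₂
      simp only [e₁, e₂, e₃, e₄] at a₁ a₂ a₃ a₄
      cases hcol : color c.1 <;> simp [hcol] at a₁ a₂ a₃ a₄ <;> omega)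
  refine ⟨fun f => -(τ f : ZMod 4), fun f i g j h => ?_⟩
  have h1 := hτ f i g j h
  simp only [ht₀ _ _ h] at h1
  have h2 := congrArg (Int.cast : ℤ → ZMod 4) h1
  have h3 : (4 : ZMod 4) = 0 := by decide
  have h4 : (2 : ZMod 4) = -2 := by decide
  have h5 : (((if color f = true then 2 else -2 : ℤ)) : ZMod 4) = 2 := by
    split_ifs
    · rfl
    · rfl
  push_cast [h3] at h2 h5
  rw [h5] at h2
  linear_combination h2

/-- Coordinates on a quadriculated disk: a function of the direction with opposite values in
opposite directions is the difference of a function on the squares. -/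
theorem IsQuadriculatedDisk.exists_coordinate [Finite F] (hG : G.IsQuadriculatedDisk)
    {r : F → ZMod 4} (hr : ∀ f i g j, G.mate (f, i) = some (g, j) →
      r g + ((j : ℕ) : ZMod 4) = r f + ((i : ℕ) : ZMod 4) + 2)
    (X : ZMod 4 → ℤ) (hX : ∀ d, X (d + 2) = -X d) :
    ∃ x : F → ℤ, ∀ f i g j, G.mate (f, i) = some (g, j) →
      x f - x g = X (r f + ((i : ℕ) : ZMod 4)) := by
  refine hG.exists_potential (fun s => X (r s.1 + ((s.2 : ℕ) : ZMod 4))) ?_ ?_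
  · rintro ⟨f, i⟩ ⟨g, j⟩ h
    simp only [hr f i g j h, hX]
  · intro c c₁ c₂ c₃ hc h₁ h₂ h₃ h₄
    have hj : ∀ j : Fin 4, (((j - 1 : Fin 4) : ℕ) : ZMod 4) = ((j : ℕ) : ZMod 4) - 1 := by
      decide
    -- Each turn changes the direction by a quarter, so the four directions at an interior vertex
    -- form two opposite pairs and the values of `X` cancel.
    have key : ∀ c c' : F × Fin 4, G.nextCorner c = some c' →
        r c'.1 + ((c'.2 : ℕ) : ZMod 4) = r c.1 + ((c.2 : ℕ) : ZMod 4) + 3 := by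
      intro c c' h
      rw [nextCorner_eq_some_iff] at h
      have := hr _ _ _ _ h
      rw [hj] at this
      linear_combination this
    have e₁ := key _ _ h₁
    have e₂ := key _ _ h₂
    have e₃ := key _ _ h₃
    simp only [e₁, e₂, e₃]
    generalize r c.1 + ((c.2 : ℕ) : ZMod 4) = d
    have h1 := hX d
    have h2 := hX (d + 3)
    have h3 : d + 3 + 3 = d + 2 := by
      rw [add_assoc]; congr 1
    rw [h3, show d + 2 + 3 = d + 3 + 2 by ring]
    linarith

/-- Two squares of a quadriculated disk share at most one side. -/
theorem IsQuadriculatedDisk.side_unique [Finite F] (hG : G.IsQuadriculatedDisk)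
    {color : F → Bool} (hcolor : G.IsBicoloring color) {f g : F} {i j i' j' : Fin 4}
    (h : G.mate (f, i) = some (g, j)) (h' : G.mate (f, i') = some (g, j')) : i = i' := by
  obtain ⟨r, hr⟩ := hG.exists_direction hcolor
  -- Grid coordinates, up to sign. The displacement between two squares determines the direction of
  -- any common side.
  obtain ⟨x, hx⟩ := hG.exists_coordinate hr ![0, 1, 0, -1] (by decide)
  obtain ⟨y, hy⟩ := hG.exists_coordinate hr ![-1, 0, 1, 0] (by decide)
  have hinj : ∀ d e : Fin 4, (![0, 1, 0, -1] : Fin 4 → ℤ) d = (![0, 1, 0, -1] : Fin 4 → ℤ) e →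
      (![-1, 0, 1, 0] : Fin 4 → ℤ) d = (![-1, 0, 1, 0] : Fin 4 → ℤ) e → d = e := by decide
  have hinj' : ∀ i i' : Fin 4, ((i : ℕ) : ZMod 4) = ((i' : ℕ) : ZMod 4) → i = i' := by decide
  have h1 := (hx f i g j h).symm.trans (hx f i' g j' h')
  have h2 := (hy f i g j h).symm.trans (hy f i' g j' h')
  exact hinj' _ _ (add_left_cancel (hinj _ _ h1 h2))

/-- A choice of signs on the squares which agree at opposite neighbors of a square and differ at
its other pairs of neighbors. -/
theorem IsQuadriculatedDisk.exists_sign [Finite F] (hG : G.IsQuadriculatedDisk)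
    {color : F → Bool} (hcolor : G.IsBicoloring color) :
    ∃ ε κ : F → ℤˣ, ∀ f i g j, G.mate (f, i) = some (g, j) → ε g = κ f * (-1) ^ (i : ℕ) := by
  obtain ⟨r, hr⟩ := hG.exists_direction hcolor
  obtain ⟨y, hy⟩ := hG.exists_coordinate hr ![-1, 0, 1, 0] (by decide)
  refine ⟨fun f => (y f).negOnePow,
    fun f => (y f).negOnePow * ((![-1, 0, 1, 0] : Fin 4 → ℤ) (r f)).negOnePow,
    fun f i g j h => ?_⟩
  have h1 := hy f i g j h
  have h2 : ∀ (d : ZMod 4) (i : Fin 4),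
      ((![-1, 0, 1, 0] : Fin 4 → ℤ) (d + ((i : ℕ) : ZMod 4))).negOnePow =
        ((![-1, 0, 1, 0] : Fin 4 → ℤ) d).negOnePow * (-1) ^ (i : ℕ) := by decide
  rw [mul_assoc]
  refine Eq.trans ?_ (congrArg _ (h2 (r f) i))
  change _ = _ * ((![-1, 0, 1, 0] : ZMod 4 → ℤ) _).negOnePow
  rw [← h1, ← Int.negOnePow_add, Int.negOnePow_eq_iff]
  exact ⟨y g - y f, by ring⟩

/-! ### Connectedness of the boundary and summation by parts -/

open Classical in
theorem IsQuadriculatedDisk.exists_vtx_single_sub_single [Finite F]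
    (hG : G.IsQuadriculatedDisk) (e₁ e₂ : F × Fin 4) (h₁ : G.mate e₁ = none)
    (h₂ : G.mate e₂ = none) :
    ∃ u : G.Vtx → ℤ, ∀ e, G.mate e = none → u (G.vtx (e.1, e.2 + 1)) - u (G.vtx e) =
      (Pi.single e₁ 1 - Pi.single e₂ 1 : F × Fin 4 → ℤ) e := by
  have := Fintype.ofFinite F
  have hsingle : ∀ (g f : F) (i : Fin 4),
      ∑ k, (Pi.single (g, i) 1 : F × Fin 4 → ℤ) (f, k) = if f = g then 1 else 0 := by
    intro g f i
    by_cases h : f = g <;> simp [Pi.single_apply, h]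
  -- A unit flow between squares across interior sides, from `e₁.1` to `f`. For `f = e₂.1` it makes
  -- the cochain `e₁ - e₂` closed without changing its boundary values.
  have hpath : ∀ f, ∃ z : F × Fin 4 → ℤ, (∀ s s', G.mate s = some s' → z s' = -z s) ∧
      (∀ s, G.mate s = none → z s = 0) ∧
      ∀ f', ∑ i, z (f', i) = (if f' = f then 1 else 0) - if f' = e₁.1 then 1 else 0 := by
    intro f
    refine hG.induction_on_squares (fun f => ∃ z : F × Fin 4 → ℤ, (∀ s s', G.mate s = some s' →
      z s' = -z s) ∧ (∀ s, G.mate s = none → z s = 0) ∧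
      ∀ f', ∑ i, z (f', i) = (if f' = f then 1 else 0) - if f' = e₁.1 then 1 else 0) ?_
      e₁.1 f ⟨0, by simp, by simp, by simp⟩
    rintro f i g j h ⟨z, hz, hz0, hzs⟩
    have h' := G.mate_symm _ _ h
    refine ⟨z + (Pi.single (g, j) 1 - Pi.single (f, i) 1), fun s s' hs => ?_, fun s hs => ?_,
      fun f' => ?_⟩
    · have hs' := G.mate_symm _ _ hs
      have a1 : s = (f, i) ↔ s' = (g, j) := by constructor <;> rintro rfl <;> simp_all
      have a2 : s = (g, j) ↔ s' = (f, i) := by constructor <;> rintro rfl <;> simp_all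
      simp only [Pi.add_apply, Pi.sub_apply, Pi.single_apply, a1, a2, hz _ _ hs]
      ring
    · have a1 : s ≠ (f, i) := by rintro rfl; simp_all
      have a2 : s ≠ (g, j) := by rintro rfl; simp_all
      simp [a1, a2, hz0 s hs]
    · simp only [Pi.add_apply, Pi.sub_apply, Finset.sum_add_distrib, Finset.sum_sub_distrib, hzs,
        hsingle]
      ring
  obtain ⟨z, hz, hz0, hzs⟩ := hpath e₂.1
  obtain ⟨u, hu⟩ := hG.exists_vtx_potential (z + (Pi.single e₁ 1 - Pi.single e₂ 1))
    (fun s s' h => by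
      have a1 : s ≠ e₁ := by rintro rfl; simp_all
      have a2 : s ≠ e₂ := by rintro rfl; simp_all
      have h' := G.mate_symm _ _ h
      have a3 : s' ≠ e₁ := by rintro rfl; simp_all
      have a4 : s' ≠ e₂ := by rintro rfl; simp_all
      simp [a1, a2, a3, a4, hz _ _ h])
    (fun f => by
      simp only [Pi.add_apply, Pi.sub_apply, Finset.sum_add_distrib, Finset.sum_sub_distrib, hzs]
      rw [hsingle e₁.1 f e₁.2, hsingle e₂.1 f e₂.2]
      ring)
  refine ⟨u, fun e he => ?_⟩
  have := hu e.1 e.2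
  simpa [hz0 e he] using this

open Classical in
/-- The boundary of a quadriculated disk is connected: a function on the boundary sides without
divergence at the boundary vertices is constant. -/
theorem IsQuadriculatedDisk.boundary_constant [Fintype F] (hG : G.IsQuadriculatedDisk)
    (θ : F × Fin 4 → ℤ)
    (hθ : ∀ u : G.Vtx → ℤ, (∑ e, if G.mate e = none then
      θ e * (u (G.vtx (e.1, e.2 + 1)) - u (G.vtx e)) else 0) = 0)
    (e₁ e₂ : F × Fin 4) (h₁ : G.mate e₁ = none) (h₂ : G.mate e₂ = none) : θ e₁ = θ e₂ := by
  obtain ⟨u, hu⟩ := hG.exists_vtx_single_sub_single e₁ e₂ h₁ h₂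
  have h := hθ u
  have : ∀ e, (if G.mate e = none then
      θ e * (u (G.vtx (e.1, e.2 + 1)) - u (G.vtx e)) else 0) =
      θ e * (Pi.single e₁ 1 - Pi.single e₂ 1 : F × Fin 4 → ℤ) e := by
    intro e
    split_ifs with he
    · rw [hu e he]
    · have a1 : e ≠ e₁ := by rintro rfl; exact he h₁
      have a2 : e ≠ e₂ := by rintro rfl; exact he h₂
      simp [a1, a2]
  rw [Finset.sum_congr rfl fun e _ => this e] at h
  simp [mul_sub, Pi.single_apply] at h
  linarith

open Classical in
/-- Summation by parts for a function on the sides. -/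
theorem sum_vtx_mul_sub [Fintype F] (y : F × Fin 4 → ℤ)
    (hy : ∀ s s', G.mate s = some s' → y s' = y s) (u : G.Vtx → ℤ) :
    (∑ c : F × Fin 4, u (G.vtx c) * (y (c.1, c.2 - 1) - y c)) =
      ∑ e : F × Fin 4, if G.mate e = none then
        y e * (u (G.vtx (e.1, e.2 + 1)) - u (G.vtx e)) else 0 := by
  have hshift : (∑ c : F × Fin 4, u (G.vtx c) * y (c.1, c.2 - 1)) =
      ∑ e : F × Fin 4, u (G.vtx (e.1, e.2 + 1)) * y e :=
    (Fintype.sum_equiv ((Equiv.refl F).prodCongr (Equiv.addRight (1 : Fin 4))) _ _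
      fun ⟨f, i⟩ => by simp).symm
  -- The two copies of an interior side carry equal `y` and opposite increments of `u`, so they
  -- cancel.
  have hinner : (∑ e : F × Fin 4, if G.mate e = none then 0 else
      y e * (u (G.vtx (e.1, e.2 + 1)) - u (G.vtx e))) = 0 := by
    refine Finset.sum_involution (fun e _ => (G.mate e).getD e) ?_ ?_ (fun _ _ => Finset.mem_univ _)
      ?_
    · rintro ⟨f, i⟩ -
      cases h : G.mate (f, i) with
      | none => simp [h]
      | some s =>
        obtain ⟨g, j⟩ := s
        simp [G.mate_symm _ _ h, hy _ _ h, vtx_of_mate h, vtx_succ_of_mate h]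
        ring
    · rintro e - hne he
      cases h : G.mate e with
      | none => simp [h] at hne
      | some s =>
        simp only [h, Option.getD_some] at he
        exact G.mate_ne_self e (by rw [h, he])
    · rintro e -
      cases h : G.mate e with
      | none => simp [h]
      | some s => simp [G.mate_symm _ _ h]
  calc _ = ∑ e : F × Fin 4, y e * (u (G.vtx (e.1, e.2 + 1)) - u (G.vtx e)) := by
        simp only [mul_sub, Finset.sum_sub_distrib, hshift]
        simp only [mul_comm]
    _ = (∑ e : F × Fin 4, y e * (u (G.vtx (e.1, e.2 + 1)) - u (G.vtx e))) -
          ∑ e : F × Fin 4, if G.mate e = none then 0 else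
            y e * (u (G.vtx (e.1, e.2 + 1)) - u (G.vtx e)) := by
        rw [hinner, sub_zero]
    _ = _ := by
        rw [← Finset.sum_sub_distrib]
        refine Finset.sum_congr rfl fun e _ => ?_
        split_ifs <;> ring

end SquareGluing

/-! ### Lifting flows modulo `n` -/

open Classical in
/-- A function on the edges of a finite directed graph whose divergence vanishes modulo `n` is
congruent modulo `n` to a function with vanishing divergence. -/
theorem exists_flow_lift {E V : Type*} [Fintype E] [Finite V] (P : E → Prop) (tail head : E → V)
    (n : ℤ) (hn : n ≠ 0) (φ : E → ℤ) (hP : ∀ e, ¬ P e → φ e = 0)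
    (hφ : ∀ u : V → ℤ, n ∣ ∑ e, φ e * (u (head e) - u (tail e))) :
    ∃ ψ : E → ℤ, (∀ e, ¬ P e → ψ e = 0) ∧ (∀ e, n ∣ ψ e - φ e) ∧
      ∀ u : V → ℤ, ∑ e, ψ e * (u (head e) - u (tail e)) = 0 := by
  have := Fintype.ofFinite V
  let S : AddSubgroup (V → ℤ) :=
    { carrier := {m | ∃ χ : E → ℤ, (∀ e, ¬ P e → χ e = 0) ∧
        ∀ u : V → ℤ, ∑ e, χ e * (u (head e) - u (tail e)) = ∑ v, m v * u v}
      zero_mem' := ⟨0, by simp, by simp⟩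
      add_mem' := by
        rintro m m' ⟨χ, h, h'⟩ ⟨χ', k, k'⟩
        refine ⟨χ + χ', fun e he => by simp [h e he, k e he], fun u => ?_⟩
        simp only [Pi.add_apply, add_mul, Finset.sum_add_distrib, h', k']
      neg_mem' := by
        rintro m ⟨χ, h, h'⟩
        refine ⟨-χ, fun e he => by simp [h e he], fun u => ?_⟩
        simp only [Pi.neg_apply, neg_mul, Finset.sum_neg_distrib, h'] }
  have hedge : ∀ e, P e → (Pi.single (head e) 1 - Pi.single (tail e) 1 : V → ℤ) ∈ S := by
    intro e he
    refine ⟨Pi.single e 1, fun e' he' => ?_, fun u => ?_⟩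
    · rw [Pi.single_apply, if_neg]
      rintro rfl
      exact he' he
    · simp [Pi.single_apply, sub_mul]
  let R : V → V → Prop := fun v w => ∃ e, P e ∧ tail e = v ∧ head e = w
  let rep : V → V := fun v => (Quot.mk R v).out
  have hrep : ∀ v, (Pi.single v 1 - Pi.single (rep v) 1 : V → ℤ) ∈ S := by
    have : ∀ v w, Quot.mk R v = Quot.mk R w → (Pi.single v 1 - Pi.single w 1 : V → ℤ) ∈ S := by
      intro v w h
      have h' := Quot.eqvGen_exact h
      induction h' with
      | rel x y hxy =>
        obtain ⟨e, he, rfl, rfl⟩ := hxy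
        simpa using S.neg_mem (hedge e he)
      | refl x => simp [S.zero_mem]
      | symm x y _ ih => simpa using S.neg_mem (ih (Quot.eqvGen_sound ‹_›))
      | trans x y z _ _ ih ih' =>
        simpa using S.add_mem (ih (Quot.eqvGen_sound ‹_›)) (ih' (Quot.eqvGen_sound ‹_›))
    exact fun v => this _ _ (Quot.out_eq _).symm
  choose m hm using fun v => hφ (Pi.single v 1)
  have hmu : ∀ u : V → ℤ, ∑ e, φ e * (u (head e) - u (tail e)) = n * ∑ v, m v * u v := by
    intro u
    have h1 : ∀ e, u (head e) - u (tail e) = ∑ v, u v *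
        ((Pi.single v 1 : V → ℤ) (head e) - (Pi.single v 1 : V → ℤ) (tail e)) := by
      intro e
      simp [Pi.single_apply, mul_sub]
    simp only [h1, Finset.mul_sum]
    rw [Finset.sum_comm]
    refine Finset.sum_congr rfl fun v _ => ?_
    rw [← mul_assoc, ← hm v, Finset.sum_mul]
    exact Finset.sum_congr rfl fun e _ => by ring
  -- The divergence of `φ` is `n * m`. Testing against the indicator of a component shows that `m`
  -- has total zero there, so `m` is the divergence of some `χ`; subtract `n • χ`.
  have hclass : ∀ w : V, ∑ v, m v * (if rep v = w then 1 else 0) = 0 := by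
    intro w
    have h1 := hmu fun v => if rep v = w then 1 else 0
    have h2 : ∑ e, φ e * ((if rep (head e) = w then 1 else 0) -
        (if rep (tail e) = w then 1 else 0)) = (0 : ℤ) := by
      refine Finset.sum_eq_zero fun e _ => ?_
      by_cases he : P e
      · have : rep (tail e) = rep (head e) :=
          congrArg Quot.out (Quot.sound ⟨e, he, rfl, rfl⟩ : Quot.mk R _ = Quot.mk R _)
        rw [this, sub_self, mul_zero]
      · rw [hP e he, zero_mul]
    rw [h2, eq_comm, mul_eq_zero] at h1
    exact h1.resolve_left hn
  have hmS : m ∈ S := by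
    have : m = ∑ v, m v • (Pi.single v 1 - Pi.single (rep v) 1 : V → ℤ) := by
      ext w
      have := hclass w
      simp only [mul_ite, mul_one, mul_zero] at this
      simp [Finset.sum_apply, Pi.single_apply, mul_sub, eq_comm (a := w), this]
    rw [this]
    exact S.sum_mem fun v _ => S.zsmul_mem (hrep v) _
  obtain ⟨χ, hχ, hχ'⟩ := hmS
  refine ⟨φ - n • χ, fun e he => by simp [hP e he, hχ e he], fun e => ⟨-χ e, ?_⟩, fun u => ?_⟩
  · simp
  · simp only [Pi.sub_apply, Pi.smul_apply, smul_eq_mul, sub_mul, Finset.sum_sub_distrib, mul_assoc]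
    rw [← Finset.mul_sum, hχ', hmu, sub_self]

namespace SquareGluing

variable {F : Type*} {G : SquareGluing F}

/-! ### Lifting kernel vectors and saturation -/

variable (G) in
/-- The sum of a function over the neighbors of a square, counted by sides. -/
def neighborSum (x : F → ℤ) (f : F) : ℤ :=
  ∑ i, (G.mate (f, i)).elim 0 fun s => x s.1

variable (G) in
/-- The value on a side of a function on the white squares: the value on the white square at this
side, if any. -/
def sideValue (color : F → Bool) (y : F → ℤ) (s : F × Fin 4) : ℤ :=
  if color s.1 = true then (G.mate s).elim 0 fun s' => y s'.1 else y s.1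

theorem sideValue_mate {color : F → Bool} (hcolor : G.IsBicoloring color) (y : F → ℤ)
    (s s' : F × Fin 4) (h : G.mate s = some s') :
    G.sideValue color y s' = G.sideValue color y s := by
  have h' := G.mate_symm _ _ h
  have hc := hcolor s.1 s'.1 ⟨s.2, s'.2, h⟩
  rcases hs : color s.1 <;> rcases hs' : color s'.1 <;> simp_all [sideValue]

theorem neighborSum_eq_of_forall {x : F → ℤ} {f : F} {k : ℤ} {y : Fin 4 → ℤ}
    (h : ∀ i, ((G.mate (f, i)).elim 0 fun s => x s.1) = k * (-1) ^ (i : ℕ) * y i) :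
    G.neighborSum x f = k * (y 0 - y 1 + y 2 - y 3) := by
  rw [neighborSum, Finset.sum_congr rfl fun i _ => h i, Fin.sum_univ_four]
  simp
  ring

/-- On a quadriculated disk, functions on the white squares with vanishing neighbor sums modulo `n`
at the black squares lift to functions with vanishing neighbor sums. -/
theorem IsQuadriculatedDisk.exists_neighborSum_eq_zero [Finite F] (hG : G.IsQuadriculatedDisk)
    {color : F → Bool} (hcolor : G.IsBicoloring color) (n : ℤ) (hn : n ≠ 0) (x : F → ℤ)
    (hx : ∀ f, color f = true → n ∣ G.neighborSum x f) :
    ∃ x' : F → ℤ, (∀ f, color f = false → n ∣ x' f - x f) ∧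
      ∀ f, color f = true → G.neighborSum x' f = 0 := by
  classical
  have := Fintype.ofFinite F
  obtain ⟨ε, κ, hε⟩ := hG.exists_sign hcolor
  have hε' : ∀ f i g j, G.mate (f, i) = some (g, j) → (ε g : ℤ) = κ f * (-1) ^ (i : ℕ) :=
    fun f i g j h => by rw [hε f i g j h]; simp
  have hεε : ∀ f, (ε f : ℤ) * ε f = 1 := fun f => Int.units_coe_mul_self _
  have hκκ : ∀ f, (κ f : ℤ) * κ f = 1 := fun f => Int.units_coe_mul_self _
  have hwhite : ∀ f i g j, color f = true → G.mate (f, i) = some (g, j) → color g = false := by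
    intro f i g j hf h
    have := hcolor f g ⟨i, j, h⟩
    rw [hf] at this
    cases hg : color g
    · rfl
    · exact absurd hg.symm this
  set y₀ := G.sideValue color fun f => ε f * x f with hy₀
  have hy₀mate : ∀ s s', G.mate s = some s' → y₀ s' = y₀ s := sideValue_mate hcolor _
  have hy₀white : ∀ f i, color f = false → y₀ (f, i) = ε f * x f := by
    intro f i hf
    simp [hy₀, sideValue, hf]
  have hy₀black : ∀ s, color s.1 = true → G.mate s = none → y₀ s = 0 := by
    intro s hs h
    simp [hy₀, sideValue, hs, h]
  let d : F × Fin 4 → ℤ := fun c => y₀ (c.1, c.2 - 1) - y₀ c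
  have hdopp : ∀ f, n ∣ y₀ (f, 0) - y₀ (f, 1) + y₀ (f, 2) - y₀ (f, 3) := by
    intro f
    cases hf : color f with
    | false => simp [hy₀white _ _ hf]
    | true =>
      have h1 : G.neighborSum x f = κ f * (y₀ (f, 0) - y₀ (f, 1) + y₀ (f, 2) - y₀ (f, 3)) := by
        refine neighborSum_eq_of_forall (y := fun i => y₀ (f, i)) fun i => ?_
        rcases h : G.mate (f, i) with _ | ⟨g, j⟩
        · simp [hy₀black (f, i) hf h]
        · rw [← hy₀mate _ _ h, hy₀white _ _ (hwhite _ _ _ _ hf h), ← hε' _ _ _ _ h]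
          simp only [Option.elim]
          linear_combination -x g * hεε g
      have h2 := (hx f hf).mul_left (κ f)
      rwa [h1, ← mul_assoc, hκκ, one_mul] at h2
  -- The edges of the flow graph: the diagonals 2→0 and 3→1 of each black square, and the boundary
  -- sides of white squares, run backwards.
  let P : F ⊕ F ⊕ F × Fin 4 → Prop := Sum.elim (fun f => color f = true)
    (Sum.elim (fun f => color f = true) fun e => color e.1 = false ∧ G.mate e = none)
  let head : F ⊕ F ⊕ F × Fin 4 → G.Vtx := Sum.elim (fun f => G.vtx (f, 0))
    (Sum.elim (fun f => G.vtx (f, 1)) fun e => G.vtx e)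
  let tail : F ⊕ F ⊕ F × Fin 4 → G.Vtx := Sum.elim (fun f => G.vtx (f, 2))
    (Sum.elim (fun f => G.vtx (f, 3)) fun e => G.vtx (e.1, e.2 + 1))
  let φ : F ⊕ F ⊕ F × Fin 4 → ℤ := Sum.elim (fun f => d (f, 0))
    (Sum.elim (fun f => d (f, 1)) fun e =>
      if color e.1 = false ∧ G.mate e = none then y₀ e else 0)
  have hdwhite : ∀ f i, color f = false → d (f, i) = 0 := by
    intro f i hf
    simp [d, hy₀white _ _ hf]
  obtain ⟨ψ, hψP, hψφ, hψ⟩ := exists_flow_lift P tail head n hn φ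
    (by
      rintro (f | f | e) he
      · exact hdwhite _ _ (by simpa [P] using he)
      · exact hdwhite _ _ (by simpa [P] using he)
      · exact if_neg he)
    (by
      intro u
      have h1 := sum_vtx_mul_sub y₀ hy₀mate u
      have h2 : ∀ e : F × Fin 4, (if G.mate e = none then
          y₀ e * (u (G.vtx (e.1, e.2 + 1)) - u (G.vtx e)) else 0) =
          -((if color e.1 = false ∧ G.mate e = none then y₀ e else 0) *
            (u (G.vtx e) - u (G.vtx (e.1, e.2 + 1)))) := by
        intro e
        by_cases h : G.mate e = none
        · cases hc : color e.1
          · simp only [h, if_true, and_self]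
            ring
          · simp [h, hy₀black e hc h]
        · simp [h]
      rw [Finset.sum_congr rfl fun e _ => h2 e, Finset.sum_neg_distrib, Fintype.sum_prod_type] at h1
      simp only [Fin.sum_univ_four] at h1
      simp only [Fintype.sum_sum_type, φ, head, tail, Sum.elim_inl, Sum.elim_inr]
      rw [eq_neg_iff_add_eq_zero, add_comm, ← eq_neg_iff_add_eq_zero] at h1
      rw [h1, ← Finset.sum_neg_distrib, ← Finset.sum_add_distrib, ← Finset.sum_add_distrib]
      refine Finset.dvd_sum fun f _ => ?_
      obtain ⟨q, hq⟩ := hdopp f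
      refine ⟨q * (u (G.vtx (f, 2)) - u (G.vtx (f, 3))), ?_⟩
      simp only [d]
      rw [show (0 : Fin 4) - 1 = 3 by decide, show (1 : Fin 4) - 1 = 0 by decide,
        show (2 : Fin 4) - 1 = 1 by decide, show (3 : Fin 4) - 1 = 2 by decide]
      linear_combination (u (G.vtx (f, 2)) - u (G.vtx (f, 3))) * hq)
  -- The jumps prescribed by the lifted flow, opposite at opposite corners. `C` sums them around
  -- each square from side 0; conservation at interior vertices lets `τ` match the values across
  -- glued sides.
  let c : F × Fin 4 → ℤ := fun s =>
    ![ψ (.inl s.1), ψ (.inr (.inl s.1)), -ψ (.inl s.1), -ψ (.inr (.inl s.1))] s.2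
  let C : F × Fin 4 → ℤ := fun s => ![0, c (s.1, 1), c (s.1, 1) + c (s.1, 2),
    c (s.1, 1) + c (s.1, 2) + c (s.1, 3)] s.2
  let η : F × Fin 4 → ℤ := fun e => ψ (.inr (.inr e))
  have hC : ∀ s, C s - C (s.1, s.2 - 1) = c s := by
    rintro ⟨f, i⟩
    fin_cases i <;> simp [C, c, show (-1 : Fin 4) = 3 by decide]
  have hCwhite : ∀ f i, color f = false → C (f, i) = 0 := by
    intro f i hf
    have h1 : ψ (.inl f) = 0 := hψP _ (by simp [P, hf])
    have h2 : ψ (.inr (.inl f)) = 0 := hψP _ (by simp [P, hf])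
    fin_cases i <;> simp [C, c, h1, h2]
  have hηmate : ∀ e, G.mate e ≠ none → η e = 0 := fun e he => hψP _ (by simp [P, he])
  have hηblack : ∀ e, color e.1 = true → η e = 0 := fun e he => hψP _ (by simp [P, he])
  have hflow : ∀ u : G.Vtx → ℤ, ∑ s, u (G.vtx s) * c s =
      ∑ e, η e * (u (G.vtx (e.1, e.2 + 1)) - u (G.vtx e)) := by
    intro u
    have h1 := hψ u
    simp only [Fintype.sum_sum_type, head, tail, Sum.elim_inl, Sum.elim_inr] at h1
    rw [← sub_eq_zero, ← h1, Fintype.sum_prod_type, sub_eq_add_neg, ← Finset.sum_neg_distrib,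
      ← add_assoc, ← Finset.sum_add_distrib]
    congr 1
    · refine Finset.sum_congr rfl fun f _ => ?_
      rw [Fin.sum_univ_four]
      simp [c]
      ring
    · exact Finset.sum_congr rfl fun e _ => by ring
  obtain ⟨τ, hτ⟩ := hG.exists_potential (fun s => (G.mate s).elim 0 fun s' => C s - C s')
    (fun s s' h => by simp [h, G.mate_symm _ _ h])
    (fun s s₁ s₂ s₃ hs h₁ h₂ h₃ h₄ => by
      obtain ⟨d₁, d₂, d₃, k₁, k₂, k₃, k₄, hd⟩ := hG.exists_four_sum hs
      obtain rfl : s₁ = d₁ := Option.some_injective _ (h₁.symm.trans k₁)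
      obtain rfl : s₂ = d₂ := Option.some_injective _ (h₂.symm.trans k₂)
      obtain rfl : s₃ = d₃ := Option.some_injective _ (h₃.symm.trans k₃)
      have e := hflow (Pi.single (G.vtx s) 1)
      have e' : ∑ e, η e * ((Pi.single (G.vtx s) 1 : G.Vtx → ℤ) (G.vtx (e.1, e.2 + 1)) -
          (Pi.single (G.vtx s) 1 : G.Vtx → ℤ) (G.vtx e)) = 0 := by
        refine Finset.sum_eq_zero fun e _ => ?_
        by_cases he : G.mate e = none
        · have := not_isCyclic_of_mate_eq_none he
          have h1 : G.vtx e ≠ G.vtx s := fun h => this.1 ((isCyclic_iff_of_vtx_eq h).2 hs)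
          have h2 : G.vtx (e.1, e.2 + 1) ≠ G.vtx s :=
            fun h => this.2 ((isCyclic_iff_of_vtx_eq h).2 hs)
          simp [h1, h2]
        · simp [hηmate e he]
      rw [e'] at e
      simp only [Pi.single_apply, ite_mul, one_mul, zero_mul] at e
      rw [hd] at e
      rw [nextCorner_eq_some_iff] at h₁ h₂ h₃ h₄
      have a₁ := hC s
      have a₂ := hC s₁
      have a₃ := hC s₂
      have a₄ := hC s₃
      simp only [h₁, h₂, h₃, h₄, Option.elim]
      linarith)
  let y₁ : F × Fin 4 → ℤ := fun s => τ s.1 - C s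
  have hy₁mate : ∀ s s', G.mate s = some s' → y₁ s' = y₁ s := by
    rintro ⟨f, i⟩ ⟨g, j⟩ h
    have := hτ f i g j h
    simp only [h, Option.elim] at this
    simp only [y₁]
    linarith
  have hy₁white : ∀ f i, color f = false → y₁ (f, i) = τ f := by
    intro f i hf
    simp [y₁, hCwhite f i hf]
  have hy₁sub : ∀ s : F × Fin 4, y₁ (s.1, s.2 - 1) - y₁ s = c s := by
    intro s
    have := hC s
    simp only [y₁]
    linarith
  obtain ⟨e₀, he₀⟩ := hG.exists_mate_eq_none hcolor
  -- Both `y₁` and `η` have the divergence of the jumps, so their difference is constant along the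
  -- connected boundary. As `η` is zero on black sides, `y₁ - k` vanishes on black boundary sides.
  have hboundary : ∀ e, G.mate e = none → y₁ e - η e = y₁ e₀ - η e₀ := by
    intro e he
    refine hG.boundary_constant (fun e => y₁ e - η e) (fun u => ?_) e e₀ he he₀
    have h1 := sum_vtx_mul_sub y₁ hy₁mate u
    rw [Finset.sum_congr rfl fun s _ => by rw [hy₁sub s], hflow] at h1
    refine Eq.trans ?_ (sub_eq_zero.2 h1.symm)
    rw [← Finset.sum_sub_distrib]
    refine Finset.sum_congr rfl fun e _ => ?_
    split_ifs with h
    · ring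
    · simp [hηmate e h]
  set k := y₁ e₀ - η e₀ with hk
  have hsq : ∀ f i, n ∣ (y₁ (f, i) - y₀ (f, i)) - (y₁ (f, 0) - y₀ (f, 0)) := by
    intro f
    have h1 := hψφ (.inr (.inl f))
    have h0 := hψφ (.inl f)
    have hopp := hdopp f
    have e1 := hy₁sub (f, 1)
    have e2 := hy₁sub (f, 2)
    have e3 := hy₁sub (f, 3)
    simp only [φ, d, c, Sum.elim_inl, Sum.elim_inr, show (0 : Fin 4) - 1 = 3 by decide,
      show (1 : Fin 4) - 1 = 0 by decide, show (2 : Fin 4) - 1 = 1 by decide,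
      show (3 : Fin 4) - 1 = 2 by decide] at h0 h1 e1 e2 e3
    simp only [Matrix.cons_val] at e1 e2 e3
    obtain ⟨q0, h0⟩ := h0
    obtain ⟨q1, h1⟩ := h1
    obtain ⟨q, hopp⟩ := hopp
    intro i
    fin_cases i
    · simp
    · exact ⟨-q1, by simp; linarith⟩
    · exact ⟨-q1 + q0 - q, by simp; linarith⟩
    · exact ⟨q0, by simp; linarith⟩
  -- `y₁` and `y₀` have congruent jumps, so their difference is constant mod `n`; at `e₀` it is
  -- congruent to `k` because `η e₀` is congruent to `y₀ e₀`.
  have hcong : ∀ f, n ∣ (y₁ (f, 0) - y₀ (f, 0)) - k := by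
    intro f
    refine hG.induction_on_squares (fun f => n ∣ (y₁ (f, 0) - y₀ (f, 0)) - k) ?_ e₀.1 f ?_
    · intro f i g j h hf
      have h1 := hsq f i
      have h2 := hsq g j
      rw [hy₁mate _ _ h, hy₀mate _ _ h] at h2
      have := (hf.add h1).sub h2
      ring_nf at this ⊢
      exact this
    · have h1 := hsq e₀.1 e₀.2
      have h2 : n ∣ η e₀ - y₀ e₀ := by
        cases hc : color e₀.1 with
        | true => simp [hηblack e₀ hc, hy₀black e₀ hc he₀]
        | false => simpa [φ, hc, he₀] using hψφ (.inr (.inr e₀))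
      have := h2.sub h1
      simp only [hk]
      ring_nf at this ⊢
      exact this
  refine ⟨fun f => ε f * (τ f - k), fun f hf => ?_, fun f hf => ?_⟩
  · have h1 := (hcong f).mul_left (ε f)
    rw [hy₁white _ _ hf, hy₀white _ _ hf] at h1
    have h2 : (ε f : ℤ) * (τ f - ε f * x f - k) = ε f * (τ f - k) - x f := by
      linear_combination -x f * hεε f
    rwa [h2] at h1
  · have h1 := neighborSum_eq_of_forall (G := G) (x := fun f => ε f * (τ f - k)) (f := f)
      (k := κ f) (y := fun i => y₁ (f, i) - k) (fun i => by
        rcases h : G.mate (f, i) with _ | ⟨g, j⟩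
        · have := hboundary _ h
          rw [hηblack (f, i) hf] at this
          simp only [Option.elim, ← this]
          ring
        · rw [← hy₁mate _ _ h, hy₁white _ _ (hwhite _ _ _ _ hf h)]
          simp only [Option.elim]
          rw [hε' _ _ _ _ h])
    have e1 := hy₁sub (f, 1)
    have e3 := hy₁sub (f, 3)
    simp only [c, show (1 : Fin 4) - 1 = 0 by decide, show (3 : Fin 4) - 1 = 2 by decide] at e1 e3
    simp only [Matrix.cons_val] at e1 e3
    rw [h1]
    have : y₁ (f, 0) - k - (y₁ (f, 1) - k) + (y₁ (f, 2) - k) - (y₁ (f, 3) - k) = 0 := by linarith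
    rw [this, mul_zero]

open Classical in
/-- The black-to-white matrix computes the neighbor sums at the black squares. -/
theorem IsQuadriculatedDisk.blackToWhite_mulVec [Finite F] (hG : G.IsQuadriculatedDisk)
    {color : F → Bool} (hcolor : G.IsBicoloring color) {b w : ℕ}
    (black : Fin b ≃ {f : F // color f = true}) (white : Fin w ≃ {f : F // color f = false})
    (x : F → ℤ) (k : Fin b) :
    (G.blackToWhite black white).mulVec (fun j => x (white j)) k =
      G.neighborSum x (black k) := by
  have h1 : ∀ i, ((G.mate (black k, i)).elim 0 fun s => x s.1) =
      ∑ l, if ∃ j, G.mate (black k, i) = some ((white l : F), j) then x (white l) else 0 := by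
    intro i
    rcases h : G.mate (black k, i) with _ | ⟨g, j⟩
    · simp
    · have hc := hcolor _ g ⟨i, j, h⟩
      rw [(black k).2, ne_comm, ne_eq, Bool.not_eq_true] at hc
      obtain ⟨l₀, hl₀⟩ := white.surjective ⟨g, hc⟩
      obtain rfl : g = white l₀ := by rw [hl₀]
      simp [Subtype.val_inj]
  simp only [neighborSum, h1]
  rw [Finset.sum_comm, Matrix.mulVec, dotProduct]
  refine Finset.sum_congr rfl fun l _ => ?_
  simp only [blackToWhite, Matrix.of_apply]
  by_cases hs : G.ShareSide (black k) (white l)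
  · obtain ⟨i₀, j₀, h₀⟩ := id hs
    -- Matrix entries are 0 or 1 while neighbor sums count sides; they agree because two squares
    -- share at most one side.
    have : ∀ i, (∃ j, G.mate (black k, i) = some ((white l : F), j)) ↔ i = i₀ := by
      intro i
      constructor
      · rintro ⟨j, hj⟩
        exact hG.side_unique hcolor hj h₀
      · rintro rfl
        exact ⟨j₀, h₀⟩
    simp [hs, this]
  · rw [if_neg hs, zero_mul, eq_comm]
    refine Finset.sum_eq_zero fun i _ => if_neg ?_
    rintro ⟨j, hj⟩
    exact hs ⟨i, j, hj⟩

/-- The image of the black-to-white matrix of a quadriculated disk is saturated. -/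
theorem IsQuadriculatedDisk.exists_mulVec_eq_of_smul [Finite F] (hG : G.IsQuadriculatedDisk)
    {color : F → Bool} (hcolor : G.IsBicoloring color) {b w : ℕ}
    (black : Fin b ≃ {f : F // color f = true}) (white : Fin w ≃ {f : F // color f = false})
    (n : ℤ) (hn : n ≠ 0) (v : Fin b → ℤ) (x : Fin w → ℤ)
    (h : (G.blackToWhite black white).mulVec x = n • v) :
    ∃ y, (G.blackToWhite black white).mulVec y = v := by
  let X : F → ℤ := fun f => if h : color f = false then x (white.symm ⟨f, h⟩) else 0
  have hX : x = fun j => X (white j) := by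
    ext j
    have := (white j).2
    simp [X, this]
  have hdvd : ∀ f, color f = true → n ∣ G.neighborSum X f := by
    intro f hf
    obtain ⟨k, hk⟩ := black.surjective ⟨f, hf⟩
    obtain rfl : f = black k := by rw [hk]
    rw [← hG.blackToWhite_mulVec hcolor black white, ← hX, h]
    exact ⟨v k, rfl⟩
  obtain ⟨X', h1, h2⟩ := hG.exists_neighborSum_eq_zero hcolor n hn X hdvd
  choose y hy using fun j => h1 (white j) (white j).2
  refine ⟨-y, ?_⟩
  have hker : (G.blackToWhite black white).mulVec (fun j => X' (white j)) = 0 := by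
    ext k
    rw [hG.blackToWhite_mulVec hcolor]
    exact h2 _ (black k).2
  have hxy : x = (fun j => X' (white j)) + n • (-y) := by
    ext j
    have := hy j
    rw [hX]
    simp only [Pi.add_apply, Pi.smul_apply, Pi.neg_apply, smul_eq_mul]
    linarith
  rw [hxy, Matrix.mulVec_add, hker, zero_add, Matrix.mulVec_smul] at h
  exact smul_right_injective _ hn h

end SquareGluing

/-! ### Ranks over fields and conclusion -/

/-- If the image of an integer matrix has a free cokernel, then its rank over every field is the
same. -/
theorem Matrix.exists_rank_map_eq_of_free {b w : ℕ} (B : Matrix (Fin b) (Fin w) ℤ)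
    [Module.Free ℤ ((Fin b → ℤ) ⧸ LinearMap.range B.mulVecLin)] :
    ∃ r : ℕ, ∀ (K : Type) [Field K], (B.map (Int.cast : ℤ → K)).rank = r := by
  set N := LinearMap.range B.mulVecLin with hN
  let e := Module.finBasis ℤ N
  set r := Module.finrank ℤ N
  -- A free cokernel splits off, giving a retraction `ρ` onto the image; the image is free, giving a
  -- section `q` of B. In a basis of the image, B = P₁Q₁ with P₂P₁ = 1 and Q₁Q₂ = 1, identities that
  -- survive reduction to any field.
  obtain ⟨s, hs⟩ := Module.projective_lifting_property N.mkQ LinearMap.id N.mkQ_surjective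
  have hs' : ∀ v, v - s (N.mkQ v) ∈ N := fun v => by
    rw [← Submodule.Quotient.mk_eq_zero, ← Submodule.mkQ_apply, map_sub, sub_eq_zero]
    exact (LinearMap.congr_fun hs (N.mkQ v)).symm
  let ρ : (Fin b → ℤ) →ₗ[ℤ] N := (LinearMap.id - s.comp N.mkQ).codRestrict N hs'
  have hρ : ρ ∘ₗ N.subtype = LinearMap.id := by
    ext v
    have : N.mkQ (v : Fin b → ℤ) = 0 := by simp
    simp [ρ, this]
  obtain ⟨q, hq⟩ := Module.projective_lifting_property B.mulVecLin.rangeRestrict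
    (LinearMap.id : N →ₗ[ℤ] N) B.mulVecLin.surjective_rangeRestrict
  let E : N ≃ₗ[ℤ] (Fin r → ℤ) := e.equivFun
  let P₁ : Matrix (Fin b) (Fin r) ℤ := LinearMap.toMatrix' (N.subtype ∘ₗ E.symm.toLinearMap)
  let P₂ : Matrix (Fin r) (Fin b) ℤ := LinearMap.toMatrix' (E.toLinearMap ∘ₗ ρ)
  let Q₁ : Matrix (Fin r) (Fin w) ℤ :=
    LinearMap.toMatrix' (E.toLinearMap ∘ₗ B.mulVecLin.rangeRestrict)
  let Q₂ : Matrix (Fin w) (Fin r) ℤ := LinearMap.toMatrix' (q ∘ₗ E.symm.toLinearMap)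
  have hB : P₁ * Q₁ = B := by
    rw [← LinearMap.toMatrix'_comp]
    have : (N.subtype ∘ₗ E.symm.toLinearMap) ∘ₗ E.toLinearMap ∘ₗ B.mulVecLin.rangeRestrict =
        B.mulVecLin := by
      ext v
      simp
    rw [this, ← Matrix.toLin'_apply', LinearMap.toMatrix'_toLin']
  have hP : P₂ * P₁ = 1 := by
    rw [← LinearMap.toMatrix'_comp]
    have : (E.toLinearMap ∘ₗ ρ) ∘ₗ N.subtype ∘ₗ E.symm.toLinearMap = LinearMap.id := by
      refine LinearMap.ext fun v => ?_
      have := LinearMap.congr_fun hρ (E.symm v)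
      simp only [LinearMap.comp_apply, LinearMap.id_apply, LinearEquiv.coe_coe] at this ⊢
      rw [this, E.apply_symm_apply]
    rw [this, LinearMap.toMatrix'_id]
  have hQ : Q₁ * Q₂ = 1 := by
    rw [← LinearMap.toMatrix'_comp]
    have : (E.toLinearMap ∘ₗ B.mulVecLin.rangeRestrict) ∘ₗ q ∘ₗ E.symm.toLinearMap =
        LinearMap.id := by
      refine LinearMap.ext fun v => ?_
      have := LinearMap.congr_fun hq (E.symm v)
      simp only [LinearMap.comp_apply, LinearMap.id_apply, LinearEquiv.coe_coe] at this ⊢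
      rw [this, E.apply_symm_apply]
    rw [this, LinearMap.toMatrix'_id]
  refine ⟨r, fun K _ => le_antisymm ?_ ?_⟩
  · have h1 : B.map (Int.castRingHom K) = P₁.map (Int.castRingHom K) * Q₁.map (Int.castRingHom K) := by
      rw [← Matrix.map_mul, hB]
    calc (B.map (Int.castRingHom K)).rank ≤ (P₁.map (Int.castRingHom K)).rank := by
          rw [h1]
          exact Matrix.rank_mul_le_left _ _
      _ ≤ r := by simpa using Matrix.rank_le_card_width (P₁.map (Int.castRingHom K))
  · have h1 : P₂.map (Int.castRingHom K) * B.map (Int.castRingHom K) *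
        Q₂.map (Int.castRingHom K) = 1 := by
      rw [← Matrix.map_mul, ← Matrix.map_mul, ← hB, ← Matrix.mul_assoc P₂, hP, Matrix.one_mul, hQ]
      simp
    have h2 : (1 : Matrix (Fin r) (Fin r) K).rank = r := by simp
    rw [← h2, ← h1]
    exact (Matrix.rank_mul_le_left _ _).trans (Matrix.rank_mul_le_right _ _)

theorem corollary3 {F : Type*} [Finite F] (G : SquareGluing F) (hG : G.IsQuadriculatedDisk)
    (color : F → Bool) (hcolor : G.IsBicoloring color) (b w : ℕ)
    (black : Fin b ≃ {f : F // color f = true}) (white : Fin w ≃ {f : F // color f = false}) :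
    (∀ v : Fin b → ℤ,
      (∃ x : Fin w → ℚ,
        ((G.blackToWhite black white).map (Int.cast : ℤ → ℚ)).mulVec x = fun i => (v i : ℚ)) →
      ∃ y : Fin w → ℤ, (G.blackToWhite black white).mulVec y = v) ∧
    Module.Free ℤ ((Fin b → ℤ) ⧸ LinearMap.range (G.blackToWhite black white).mulVecLin) ∧
    ∀ p : ℕ, p.Prime →
      ((G.blackToWhite black white).map (Int.cast : ℤ → ZMod p)).rank =
        ((G.blackToWhite black white).map (Int.cast : ℤ → ℚ)).rank := by
  have hsat := fun n hn v x => hG.exists_mulVec_eq_of_smul hcolor black white n hn v x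
  set B := G.blackToWhite black white
  have hfree : Module.Free ℤ ((Fin b → ℤ) ⧸ LinearMap.range B.mulVecLin) := by
    have : Module.IsTorsionFree ℤ ((Fin b → ℤ) ⧸ LinearMap.range B.mulVecLin) := by
      rw [Module.isTorsionFree_iff_smul_eq_zero]
      rintro n q h
      obtain ⟨v, rfl⟩ := Submodule.mkQ_surjective _ q
      by_cases hn : n = 0
      · exact .inl hn
      right
      rw [← map_smul, Submodule.mkQ_apply, Submodule.Quotient.mk_eq_zero] at h
      obtain ⟨x, hx⟩ := h
      obtain ⟨y, hy⟩ := hsat n hn v x hx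
      rw [Submodule.mkQ_apply, Submodule.Quotient.mk_eq_zero]
      exact ⟨y, hy⟩
    exact Module.free_of_finite_type_torsion_free'
  refine ⟨?_, hfree, ?_⟩
  · rintro v ⟨x, hx⟩
    -- Clearing denominators turns a rational solution into B z = n v, where saturation applies.
    obtain ⟨⟨n, hn⟩, hnx⟩ := IsLocalization.exist_integer_multiples_of_finite
      (nonZeroDivisors ℤ) x
    choose z hz using hnx
    refine hsat n (nonZeroDivisors.ne_zero hn) v z (funext fun i => ?_)
    have h1 := congrFun hx i
    have h2 : ((B.mulVec z i : ℤ) : ℚ) = n * v i := by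
      rw [← h1]
      simp only [Matrix.mulVec, dotProduct, Matrix.map_apply, Finset.mul_sum]
      push_cast
      refine Finset.sum_congr rfl fun j _ => ?_
      have h3 : (z j : ℚ) = n * x j := by simpa [Submonoid.smul_def] using hz j
      rw [h3]
      ring
    exact_mod_cast h2
  · intro p hp
    have := Fact.mk hp
    obtain ⟨r, hr⟩ := B.exists_rank_map_eq_of_free
    rw [hr, hr]
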